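/- Let $n\ge 2$ and let $A_n$ be the free associative unital $\mathbb C$-algebra on generators $x_1,\dots,x_n$. Put $L_1(A_n)=A_n$ and $L_{i+1}(A_n)=[A_n,L_i(A_n)]$, where $[a,b]=ab-ba$. Let $M_{n,i}$ be the two-sided ideal of $A_n$ generated by $L_i(A_n)$, and let $Q_{n,i}=A_n/M_{n,i}$. Let $\ell_n\subset A_n$ be the free Lie algebra on $x_1,\dots,x_n$, so that $A_n=U(\ell_n)$, and let $\ell_n'=[\ell_n,\ell_n]$. The Lie filtration of $A_n$ (whose $d$-th step is spanned by the products of at most $d$ elements of $\ell_n$) induces a filtration on $Q_{n,i}$; let $D_{n,i}=\operatorname{gr}Q_{n,i}$ be the associated graded algebra, which is a quotient of $\operatorname{gr}A_n=\operatorname{Sym}\ell_n$. Let $\Lambda_{n,i}$ be the image of $\operatorname{Sym}\ell_n'$ in $D_{n,i}$, that is, the subalgebra of $D_{n,i}$ generated by the image of $\ell_n'$ in degree one. The group $GL(n)=GL_n(\mathbb C)$ acts on $A_n$ by linear substitutions of the generators, which span the vector representation $V=\mathbb C^n$, and hence acts on $Q_{n,i}$, $D_{n,i}$ and $\Lambda_{n,i}$.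 Let $K_{n,3}$ be the kernel of the natural projection $\Lambda_{n,4}\to\Lambda_{n,3}$. For a partition $\mu$ with at most $n$ parts, let $F_\mu$ be the irreducible representation of $GL(n)$ corresponding to $\mu$, realised as the image of the Young symmetrizer of $\mu$ on $V^{\otimes|\mu|}$. Then $F_{(2,1)}$ and $F_{(2,2)}$ are irreducible, and there is an isomorphism of $GL(n)$-modules $$K_{n,3}\;\cong\;F_{(2,1)}\oplus F_{(2,2)}.$$ -/

import Mathlib

open scoped TensorProduct Polynomial

noncomputable section

namespace LieNilpotent

/-! ### Lower central series of an associative algebra and the quotients `Q_i(A)` -/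

section Quotients

attribute [local instance] LieRing.ofAssociativeRing

variable (A : Type*) [Ring A] [Algebra ℂ A]

/-- `L_i(A)` for `i ≥ 1`: `L_1(A) = A` and `L_{i+1}(A) = [A, L_i(A)]`, for the commutator bracket.
Mathlib numbers the lower central series from `0`. -/
def lowerCentral (i : ℕ) : LieSubmodule ℂ A A :=
  LieModule.lowerCentralSeries ℂ A A (i - 1)

/-- `M_i(A) = A L_i(A) A`, the two-sided ideal generated by `L_i(A)`. -/
def idealM (i : ℕ) : TwoSidedIdeal A :=
  TwoSidedIdeal.span (lowerCentral A i : Set A)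

/-- `Q_i(A) = A / M_i(A)`. -/
def Q (i : ℕ) : Type _ := (idealM A i).ringCon.Quotient

instance (i : ℕ) : Ring (Q A i) := inferInstanceAs (Ring (idealM A i).ringCon.Quotient)

instance (i : ℕ) : Algebra ℂ (Q A i) :=
  inferInstanceAs (Algebra ℂ (idealM A i).ringCon.Quotient)

/-- The quotient map `A → Q_i(A)`. -/
def Q.mk (i : ℕ) : A →ₐ[ℂ] Q A i := RingCon.mkₐ ℂ (idealM A i).ringCon

variable {A} {B C : Type*} [Ring B] [Algebra ℂ B] [Ring C] [Algebra ℂ C]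

theorem Q.mk_surjective (i : ℕ) : Function.Surjective (Q.mk A i) :=
  RingCon.mkₐ_surjective (α := ℂ) _

theorem Q.mk_eq_zero {i : ℕ} {a : A} : Q.mk A i a = 0 ↔ a ∈ idealM A i := by
  rw [TwoSidedIdeal.mem_iff]
  exact Quotient.eq''

theorem map_mem_lowerCentral (f : A →ₐ[ℂ] B) (i : ℕ) {a : A} (ha : a ∈ lowerCentral A i) :
    f a ∈ lowerCentral B i :=
  LieIdeal.map_lowerCentralSeries_le (i - 1) (f := (f : A →ₗ⁅ℂ⁆ B)) (LieIdeal.mem_map ha)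

theorem map_mem_idealM (f : A →ₐ[ℂ] B) (i : ℕ) {a : A} (ha : a ∈ idealM A i) :
    f a ∈ idealM B i := by
  have h : idealM A i ≤ (idealM B i).comap f := by
    refine TwoSidedIdeal.span_le.2 fun x hx => ?_
    exact (TwoSidedIdeal.mem_comap f).2
      (TwoSidedIdeal.subset_span (map_mem_lowerCentral f i hx))
  exact (TwoSidedIdeal.mem_comap f).1 (h ha)

theorem idealM_succ_le (i : ℕ) : idealM A (i + 1) ≤ idealM A i := by
  refine TwoSidedIdeal.span_mono fun x hx => ?_
  exact LieModule.antitone_lowerCentralSeries ℂ A A (by omega : i - 1 ≤ i + 1 - 1) hx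

theorem Q.lift_aux {i : ℕ} (f : A →ₐ[ℂ] B) (hf : ∀ a ∈ idealM A i, f a = 0) :
    (idealM A i).ringCon ≤ RingCon.ker f.toRingHom := by
  intro x y hxy
  have h := hf _ ((TwoSidedIdeal.rel_iff _ _ _).1 hxy)
  rw [map_sub] at h
  exact (RingCon.ker_apply _).2 (sub_eq_zero.1 h)

/-- The homomorphism `Q_i(A) → Q_i(B)` induced by an algebra homomorphism `A → B`. -/
def Q.map (i : ℕ) (f : A →ₐ[ℂ] B) : Q A i →ₐ[ℂ] Q B i :=
  RingCon.liftₐ _ ((Q.mk B i).comp f)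
    (Q.lift_aux _ fun _ ha => Q.mk_eq_zero.2 (map_mem_idealM f i ha))

@[simp] theorem Q.map_mk (i : ℕ) (f : A →ₐ[ℂ] B) (a : A) :
    Q.map i f (Q.mk A i a) = Q.mk B i (f a) := rfl

variable (A) in
/-- The projection `Q_{i+1}(A) → Q_i(A)`. -/
def Q.proj (i : ℕ) : Q A (i + 1) →ₐ[ℂ] Q A i :=
  RingCon.liftₐ _ (Q.mk A i)
    (Q.lift_aux _ fun _ ha => Q.mk_eq_zero.2 (idealM_succ_le i ha))

@[simp] theorem Q.proj_mk (i : ℕ) (a : A) : Q.proj A i (Q.mk A (i + 1) a) = Q.mk A i a := rfl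

end Quotients

/-! ### The associated graded algebra of a filtered algebra -/

section AssociatedGraded

variable {A B C : Type*} [Ring A] [Algebra ℂ A] [Ring B] [Algebra ℂ B] [Ring C] [Algebra ℂ C]

/-- The preceding step `F_{d-1}` of a filtration, with `F_{-1} = 0`. -/
def below (F : ℕ → Submodule ℂ A) : ℕ → Submodule ℂ A
  | 0 => ⊥
  | d + 1 => F d

theorem isRingFiltration_below {F : ℕ → Submodule ℂ A} (hF : Monotone F)
    (h1 : (1 : A) ∈ F 0) (hmul : ∀ i j a b, a ∈ F i → b ∈ F j → a * b ∈ F (i + j)) :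
    IsRingFiltration F (below F) where
  mono := hF
  is_le {i j} hij := by
    cases j with
    | zero => omega
    | succ j => exact hF (by omega)
  is_sup B j h := by
    cases j with
    | zero => exact bot_le
    | succ j => exact h j (by omega)
  one_mem := h1
  mul_mem _ _ _ _ ha hb := hmul _ _ _ _ ha hb

theorem map_mem_below {F : ℕ → Submodule ℂ A} {G : ℕ → Submodule ℂ B} {f : A →ₐ[ℂ] B}
    (hf : ∀ d, ∀ a ∈ F d, f a ∈ G d) {d : ℕ} {a : A} (ha : a ∈ below F d) : f a ∈ below G d := by
  cases d with
  | zero => rw [(Submodule.mem_bot ℂ).1 ha, map_zero]; exact zero_mem _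
  | succ d => exact hf d a ha

section Basic

variable (F : ℕ → Submodule ℂ A) [IsRingFiltration F (below F)]

theorem mul_mem_below_left {i j : ℕ} {a b : A} (ha : a ∈ below F i) (hb : b ∈ F j) :
    a * b ∈ below F (i + j) := by
  cases i with
  | zero => rw [(Submodule.mem_bot ℂ).1 ha, zero_mul]; exact zero_mem _
  | succ i =>
    rw [show i + 1 + j = (i + j) + 1 by omega]
    exact SetLike.GradedMul.mul_mem (A := F) ha hb

theorem mul_mem_below_right {i j : ℕ} {a b : A} (ha : a ∈ F i) (hb : b ∈ below F j) :
    a * b ∈ below F (i + j) := by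
  cases j with
  | zero => rw [(Submodule.mem_bot ℂ).1 hb, mul_zero]; exact zero_mem _
  | succ j => exact SetLike.GradedMul.mul_mem (A := F) ha hb

/-- The Rees algebra `⊕_d F_d t^d`, inside the polynomial ring `A[t]`. -/
def rees : Subalgebra ℂ A[X] where
  carrier := {p | ∀ d, p.coeff d ∈ F d}
  mul_mem' {p q} hp hq d := by
    rw [Polynomial.coeff_mul]
    refine Submodule.sum_mem _ fun x hx => ?_
    rw [← Finset.HasAntidiagonal.mem_antidiagonal.1 hx]
    exact SetLike.GradedMul.mul_mem (A := F) (hp _) (hq _)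
  add_mem' {p q} hp hq d := by
    rw [Polynomial.coeff_add]; exact add_mem (hp d) (hq d)
  algebraMap_mem' c d := by
    rw [Polynomial.algebraMap_apply, Polynomial.coeff_C]
    split_ifs with h
    · subst h
      rw [Algebra.algebraMap_eq_smul_one]
      exact Submodule.smul_mem _ _ (SetLike.GradedOne.one_mem (A := F))
    · exact zero_mem _

/-- The two-sided ideal `⊕_d F_{d-1} t^d` of the Rees algebra. -/
def grIdeal : TwoSidedIdeal (rees F) :=
  TwoSidedIdeal.mk' {p | ∀ d, (p : A[X]).coeff d ∈ below F d}
    (fun d => by simp)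
    (fun {x y} hx hy d => by
      have := add_mem (hx d) (hy d)
      simpa using this)
    (fun {x} hx d => by
      have := neg_mem (hx d)
      simpa using this)
    (fun {x y} hy d => by
      rw [MulMemClass.coe_mul, Polynomial.coeff_mul]
      refine Submodule.sum_mem _ fun z hz => ?_
      rw [← Finset.HasAntidiagonal.mem_antidiagonal.1 hz]
      exact mul_mem_below_right F (x.2 _) (hy _))
    (fun {x y} hx d => by
      rw [MulMemClass.coe_mul, Polynomial.coeff_mul]
      refine Submodule.sum_mem _ fun z hz => ?_
      rw [← Finset.HasAntidiagonal.mem_antidiagonal.1 hz]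
      exact mul_mem_below_left F (hx _) (y.2 _))

theorem mem_grIdeal {p : rees F} : p ∈ grIdeal F ↔ ∀ d, (p : A[X]).coeff d ∈ below F d :=
  TwoSidedIdeal.mem_mk' ..

/-- The associated graded algebra `gr A = ⊕_d F_d / F_{d-1}` of a filtered algebra, with the product
`(a + F_{i-1}) (b + F_{j-1}) = a b + F_{i+j-1}`: the quotient of the Rees algebra `⊕_d F_d t^d`
by its ideal `⊕_d F_{d-1} t^d`. -/
def Gr : Type _ := (grIdeal F).ringCon.Quotient

instance : Ring (Gr F) := inferInstanceAs (Ring (grIdeal F).ringCon.Quotient)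

instance : Algebra ℂ (Gr F) := inferInstanceAs (Algebra ℂ (grIdeal F).ringCon.Quotient)

/-- The quotient map from the Rees algebra to the associated graded algebra. -/
def Gr.mk : rees F →ₐ[ℂ] Gr F := RingCon.mkₐ ℂ (grIdeal F).ringCon

theorem Gr.mk_eq_zero {p : rees F} :
    Gr.mk F p = 0 ↔ ∀ d, (p : A[X]).coeff d ∈ below F d := by
  rw [← mem_grIdeal, TwoSidedIdeal.mem_iff]
  exact Quotient.eq''

/-- The symbol map `F_d → F_d / F_{d-1} ⊆ gr A`. -/
def Gr.symbol (d : ℕ) : F d →ₗ[ℂ] Gr F where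
  toFun a := Gr.mk F ⟨Polynomial.monomial d (a : A), fun e => by
    rw [Polynomial.coeff_monomial]
    split_ifs with h
    · exact h ▸ a.2
    · exact zero_mem _⟩
  map_add' a b := by
    rw [← map_add]
    exact congrArg (Gr.mk F) (Subtype.ext (map_add (Polynomial.monomial d) (a : A) (b : A)))
  map_smul' c a := by
    rw [RingHom.id_apply, ← map_smul]
    exact congrArg (Gr.mk F)
      (Subtype.ext (Polynomial.smul_monomial c d (a : A)).symm)

end Basic

variable {F : ℕ → Submodule ℂ A} [IsRingFiltration F (below F)]
  {G : ℕ → Submodule ℂ B} [IsRingFiltration G (below G)]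
  {H : ℕ → Submodule ℂ C} [IsRingFiltration H (below H)]

/-- The map of Rees algebras induced by a filtered homomorphism. -/
def reesMap (f : A →ₐ[ℂ] B) (hf : ∀ d, ∀ a ∈ F d, f a ∈ G d) : rees F →ₐ[ℂ] rees G :=
  ((Polynomial.mapAlgHom f).comp (rees F).val).codRestrict (rees G) fun p d => by
    have := hf d _ (p.2 d)
    simpa using this

@[simp] theorem coeff_reesMap (f : A →ₐ[ℂ] B) (hf : ∀ d, ∀ a ∈ F d, f a ∈ G d) (p : rees F)
    (d : ℕ) : (reesMap f hf p : B[X]).coeff d = f ((p : A[X]).coeff d) := by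
  change (Polynomial.mapAlgHom f (p : A[X])).coeff d = _
  simp

/-- The homomorphism `gr A → gr B` induced by a filtered homomorphism `A → B`. -/
def Gr.map (f : A →ₐ[ℂ] B) (hf : ∀ d, ∀ a ∈ F d, f a ∈ G d) : Gr F →ₐ[ℂ] Gr G :=
  RingCon.liftₐ _ ((Gr.mk G).comp (reesMap f hf)) (by
    intro x y hxy
    have h := (mem_grIdeal F).1 ((TwoSidedIdeal.rel_iff _ _ _).1 hxy)
    refine (RingCon.ker_apply _).2 (sub_eq_zero.1 ?_)
    rw [← map_sub]
    refine (Gr.mk_eq_zero G).2 fun d => ?_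
    have h' := map_mem_below hf (h d)
    rwa [← coeff_reesMap f hf (x - y) d] at h')

theorem Gr.map_mk (f : A →ₐ[ℂ] B) (hf : ∀ d, ∀ a ∈ F d, f a ∈ G d) (p : rees F) :
    Gr.map f hf (Gr.mk F p) = Gr.mk G (reesMap f hf p) := rfl

theorem Gr.map_symbol (f : A →ₐ[ℂ] B) (hf : ∀ d, ∀ a ∈ F d, f a ∈ G d) (d : ℕ) (a : F d) :
    Gr.map f hf (Gr.symbol F d a) = Gr.symbol G d ⟨f a, hf d a a.2⟩ := by
  change Gr.map f hf (Gr.mk F _) = Gr.mk G _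
  rw [Gr.map_mk]
  refine congrArg (Gr.mk G) (Subtype.ext ?_)
  change Polynomial.mapAlgHom f (Polynomial.monomial d (a : A)) = _
  simp

theorem Gr.mk_surjective : Function.Surjective (Gr.mk F) :=
  RingCon.mkₐ_surjective (α := ℂ) _

theorem Gr.map_eq_id (f : A →ₐ[ℂ] A) (hf : ∀ d, ∀ a ∈ F d, f a ∈ F d) (h : ∀ a, f a = a)
    (x : Gr F) : Gr.map f hf x = x := by
  obtain ⟨p, rfl⟩ := Gr.mk_surjective x
  rw [Gr.map_mk]
  congr 1
  ext d
  rw [coeff_reesMap, h]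

theorem Gr.map_map (f : A →ₐ[ℂ] B) (hf : ∀ d, ∀ a ∈ F d, f a ∈ G d)
    (g : B →ₐ[ℂ] C) (hg : ∀ d, ∀ b ∈ G d, g b ∈ H d)
    (k : A →ₐ[ℂ] C) (hk : ∀ d, ∀ a ∈ F d, k a ∈ H d) (h : ∀ a, k a = g (f a)) (x : Gr F) :
    Gr.map k hk x = Gr.map g hg (Gr.map f hf x) := by
  obtain ⟨p, rfl⟩ := Gr.mk_surjective x
  rw [Gr.map_mk, Gr.map_mk, Gr.map_mk]
  congr 1
  ext d
  simp [h]

end AssociatedGraded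

/-! ### The free algebra `A_n`, its Lie filtration, and the algebras `D_{n,i}`, `Λ_{n,i}` -/

section FreeAlgebra

attribute [local instance] LieRing.ofAssociativeRing

variable (n : ℕ)

/-- `A_n`, the free associative `ℂ`-algebra on `n` generators. -/
abbrev An : Type := FreeAlgebra ℂ (Fin n)

/-- The free Lie algebra `ℓ_n` on the same generators, viewed inside `A_n = U(ℓ_n)`. -/
def freeLie : LieSubalgebra ℂ (An n) :=
  (FreeLieAlgebra.lift ℂ (FreeAlgebra.ι ℂ : Fin n → An n)).range

/-- `ℓ_n' = [ℓ_n, ℓ_n]`, the span of all brackets of elements of `ℓ_n`. -/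
def derivedLie : Submodule ℂ (An n) :=
  Submodule.span ℂ {c | ∃ a ∈ freeLie n, ∃ b ∈ freeLie n, ⁅a, b⁆ = c}

/-- The Lie filtration of `A_n`: the `d`-th step is spanned by the products of at most `d` elements
of `ℓ_n`. -/
def lieFil (d : ℕ) : Submodule ℂ (An n) :=
  (1 ⊔ (freeLie n).toSubmodule) ^ d

theorem lieFil_mono : Monotone (lieFil n) := by
  intro a b h
  exact pow_le_pow_right' (le_sup_left : (1 : Submodule ℂ (An n)) ≤ _) h

theorem derivedLie_le_freeLie : derivedLie n ≤ (freeLie n).toSubmodule := by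
  refine Submodule.span_le.2 ?_
  rintro _ ⟨a, ha, b, hb, rfl⟩
  exact (freeLie n).lie_mem ha hb

theorem freeLie_le_lieFil_one : (freeLie n).toSubmodule ≤ lieFil n 1 := by
  rw [lieFil, pow_one]
  exact le_sup_right

/-- The induced filtration of `Q_{n,i} = Q_i(A_n)`. -/
def qFil (i d : ℕ) : Submodule ℂ (Q (An n) i) :=
  (lieFil n d).map (Q.mk (An n) i).toLinearMap

instance qFil_isRingFiltration (i : ℕ) : IsRingFiltration (qFil n i) (below (qFil n i)) := by
  refine isRingFiltration_below (fun a b h => Submodule.map_mono (lieFil_mono n h))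
    ⟨1, ?_, map_one (Q.mk (An n) i)⟩ ?_
  · rw [lieFil, pow_zero]
    exact Submodule.one_le.1 le_rfl
  · rintro d e _ _ ⟨a, ha, rfl⟩ ⟨b, hb, rfl⟩
    refine ⟨a * b, ?_, map_mul (Q.mk (An n) i) a b⟩
    have := Submodule.mul_mem_mul ha hb
    rwa [lieFil, lieFil, ← pow_add] at this

/-- `D_{n,i} = gr Q_{n,i}`. -/
abbrev D (i : ℕ) : Type := Gr (qFil n i)

theorem mk_mem_qFil_one (i : ℕ) (a : derivedLie n) : Q.mk (An n) i a ∈ qFil n i 1 :=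
  ⟨a, freeLie_le_lieFil_one n (derivedLie_le_freeLie n a.2), rfl⟩

/-- The natural linear map `ℓ_n' → D_{n,i}`, with values in degree one. -/
def derivedSymbol (i : ℕ) : derivedLie n →ₗ[ℂ] D n i :=
  Gr.symbol (qFil n i) 1 ∘ₗ
    ((Q.mk (An n) i).toLinearMap ∘ₗ (derivedLie n).subtype).codRestrict (qFil n i 1)
      fun a => mk_mem_qFil_one n i a

/-- `Λ_{n,i}`, the image of `Sym ℓ_n'` in `D_{n,i}`: the subalgebra generated by the image
of `ℓ_n'`. -/
def Lam (i : ℕ) : Subalgebra ℂ (D n i) :=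
  Algebra.adjoin ℂ (Set.range (derivedSymbol n i))

end FreeAlgebra

/-! ### The action of `GL(n)` -/

section Action

attribute [local instance] LieRing.ofAssociativeRing

variable {n : ℕ}

/-- The linear substitution `x_j ↦ ∑_i g_{ij} x_i` of `A_n`. -/
def glAlg (g : GL (Fin n) ℂ) : An n →ₐ[ℂ] An n :=
  FreeAlgebra.lift ℂ fun j => ∑ i, g.1 i j • FreeAlgebra.ι ℂ i

@[simp] theorem glAlg_ι (g : GL (Fin n) ℂ) (j : Fin n) :
    glAlg g (FreeAlgebra.ι ℂ j) = ∑ i, g.1 i j • FreeAlgebra.ι ℂ i := by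
  simp [glAlg]

theorem glAlg_one (a : An n) : glAlg (1 : GL (Fin n) ℂ) a = a := by
  suffices h : glAlg (1 : GL (Fin n) ℂ) = AlgHom.id ℂ _ by rw [h]; rfl
  ext j
  simp [Matrix.one_apply]

theorem glAlg_mul (g h : GL (Fin n) ℂ) (a : An n) : glAlg (g * h) a = glAlg g (glAlg h a) := by
  suffices H : glAlg (g * h) = (glAlg g).comp (glAlg h) by rw [H]; rfl
  ext j
  simp only [Function.comp_apply, AlgHom.comp_apply, glAlg_ι, map_sum, map_smul, Units.val_mul,
    Matrix.mul_apply, Finset.sum_smul, Finset.smul_sum, smul_smul]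
  rw [Finset.sum_comm]
  simp only [mul_comm]

theorem glAlg_mem_freeLie (g : GL (Fin n) ℂ) {a : An n} (ha : a ∈ freeLie n) :
    glAlg g a ∈ freeLie n := by
  obtain ⟨x, rfl⟩ := ha
  let φ : FreeLieAlgebra ℂ (Fin n) →ₗ⁅ℂ⁆ FreeLieAlgebra ℂ (Fin n) :=
    FreeLieAlgebra.lift ℂ fun j => ∑ i, g.1 i j • FreeLieAlgebra.of ℂ i
  let u : FreeLieAlgebra ℂ (Fin n) →ₗ⁅ℂ⁆ An n := FreeLieAlgebra.lift ℂ (FreeAlgebra.ι ℂ)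
  have h : ((glAlg g : An n →ₗ⁅ℂ⁆ An n)).comp u = u.comp φ := by
    ext j
    simp [u, φ, map_sum]
  exact ⟨φ x, (LieHom.congr_fun h x).symm⟩

theorem glAlg_mem_derivedLie (g : GL (Fin n) ℂ) {a : An n} (ha : a ∈ derivedLie n) :
    glAlg g a ∈ derivedLie n := by
  have h : derivedLie n ≤ (derivedLie n).comap (glAlg g).toLinearMap := by
    refine Submodule.span_le.2 ?_
    rintro _ ⟨a, ha, b, hb, rfl⟩
    refine Submodule.subset_span ⟨_, glAlg_mem_freeLie g ha, _, glAlg_mem_freeLie g hb, ?_⟩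
    simp [LieRing.of_associative_ring_bracket]
  exact h ha

theorem glAlg_mem_lieFil (g : GL (Fin n) ℂ) (d : ℕ) {a : An n} (ha : a ∈ lieFil n d) :
    glAlg g a ∈ lieFil n d := by
  have h1 : (1 ⊔ (freeLie n).toSubmodule).map (glAlg g).toLinearMap
      ≤ 1 ⊔ (freeLie n).toSubmodule := by
    rw [Submodule.map_sup, Submodule.map_one]
    refine sup_le_sup le_rfl ?_
    rintro _ ⟨a, ha, rfl⟩
    exact glAlg_mem_freeLie g ha
  have h2 : (lieFil n d).map (glAlg g).toLinearMap ≤ lieFil n d := by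
    rw [lieFil, Submodule.map_pow]
    exact pow_le_pow_left' h1 d
  exact h2 ⟨a, ha, rfl⟩

theorem map_glAlg_mem_qFil (i : ℕ) (g : GL (Fin n) ℂ) (d : ℕ) (a : Q (An n) i)
    (ha : a ∈ qFil n i d) : Q.map i (glAlg g) a ∈ qFil n i d := by
  obtain ⟨b, hb, rfl⟩ := ha
  exact ⟨_, glAlg_mem_lieFil g d hb, rfl⟩

theorem proj_mem_qFil (i : ℕ) (d : ℕ) (a : Q (An n) (i + 1))
    (ha : a ∈ qFil n (i + 1) d) : Q.proj (An n) i a ∈ qFil n i d := by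
  obtain ⟨b, hb, rfl⟩ := ha
  exact ⟨b, hb, rfl⟩

/-- The action of `g ∈ GL(n)` on `D_{n,i}`. -/
def glD (i : ℕ) (g : GL (Fin n) ℂ) : D n i →ₐ[ℂ] D n i :=
  Gr.map (Q.map i (glAlg g)) (map_glAlg_mem_qFil i g)

variable (n) in
/-- The projection `D_{n,i+1} → D_{n,i}`. -/
def projD (i : ℕ) : D n (i + 1) →ₐ[ℂ] D n i :=
  Gr.map (Q.proj (An n) i) (proj_mem_qFil i)

theorem glD_one (i : ℕ) (x : D n i) : glD i (1 : GL (Fin n) ℂ) x = x :=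
  Gr.map_eq_id _ _ (fun a => by
    obtain ⟨a, rfl⟩ := Q.mk_surjective i a
    rw [Q.map_mk, glAlg_one]) x

theorem glD_mul (i : ℕ) (g h : GL (Fin n) ℂ) (x : D n i) :
    glD i (g * h) x = glD i g (glD i h x) :=
  Gr.map_map _ _ _ _ _ _ (fun a => by
    obtain ⟨a, rfl⟩ := Q.mk_surjective i a
    simp only [Q.map_mk, glAlg_mul]) x

theorem projD_glD (i : ℕ) (g : GL (Fin n) ℂ) (x : D n (i + 1)) :
    projD n i (glD (i + 1) g x) = glD i g (projD n i x) := by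
  have hk : ∀ d, ∀ a ∈ qFil n (i + 1) d,
      ((Q.proj (An n) i).comp (Q.map (i + 1) (glAlg g))) a ∈ qFil n i d :=
    fun d a ha => proj_mem_qFil i d _ (map_glAlg_mem_qFil (i + 1) g d a ha)
  refine (Gr.map_map _ _ _ _ ((Q.proj (An n) i).comp (Q.map (i + 1) (glAlg g))) hk
    (fun _ => rfl) x).symm.trans (Gr.map_map _ _ _ _ _ hk (fun a => ?_) x)
  obtain ⟨a, rfl⟩ := Q.mk_surjective _ a
  rfl

theorem glD_mem_Lam (i : ℕ) (g : GL (Fin n) ℂ) {x : D n i} (hx : x ∈ Lam n i) :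
    glD i g x ∈ Lam n i := by
  have h : Lam n i ≤ (Lam n i).comap (glD i g) := by
    refine Algebra.adjoin_le ?_
    rintro _ ⟨a, rfl⟩
    refine Algebra.subset_adjoin ⟨⟨glAlg g a, glAlg_mem_derivedLie g a.2⟩, ?_⟩
    exact (Gr.map_symbol _ (map_glAlg_mem_qFil i g) 1
      ⟨Q.mk (An n) i a, mk_mem_qFil_one n i a⟩).symm
  exact h hx

theorem projD_mem_Lam (i : ℕ) {x : D n (i + 1)} (hx : x ∈ Lam n (i + 1)) :
    projD n i x ∈ Lam n i := by
  have h : Lam n (i + 1) ≤ (Lam n i).comap (projD n i) := by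
    refine Algebra.adjoin_le ?_
    rintro _ ⟨a, rfl⟩
    refine Algebra.subset_adjoin ⟨a, ?_⟩
    exact (Gr.map_symbol _ (proj_mem_qFil i) 1
      ⟨Q.mk (An n) (i + 1) a, mk_mem_qFil_one n (i + 1) a⟩).symm
  exact h hx

variable (n)

/-- `Λ_{n,i}` as a representation of `GL(n)`. -/
def lamRep (i : ℕ) : Representation ℂ (GL (Fin n) ℂ) (Lam n i) where
  toFun g := (glD i g).toLinearMap.restrict (p := (Lam n i).toSubmodule)
    (q := (Lam n i).toSubmodule) fun _ hx => glD_mem_Lam i g hx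
  map_one' := LinearMap.ext fun x => Subtype.ext (glD_one i x.1)
  map_mul' g h := LinearMap.ext fun x => Subtype.ext (glD_mul i g h x.1)

/-- The `GL(n)`-equivariant projection `Λ_{n,i+1} → Λ_{n,i}`. -/
def projLam (i : ℕ) : (lamRep n (i + 1)).IntertwiningMap (lamRep n i) where
  toLinearMap := (projD n i).toLinearMap.restrict (p := (Lam n (i + 1)).toSubmodule)
    (q := (Lam n i).toSubmodule) fun _ hx => projD_mem_Lam i hx
  isIntertwining' g := LinearMap.ext fun x => Subtype.ext (projD_glD i g x.1)

/-- `K_{n,i}`, the kernel of `Λ_{n,i+1} → Λ_{n,i}`, as a subrepresentation of `Λ_{n,i+1}`. -/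
def K (i : ℕ) : Subrepresentation (lamRep n (i + 1)) := (projLam n i).ker

end Action

/-! ### The representation `F_μ` of `GL(n)` attached to a partition -/

section Schur

/-- The vector representation `V = ℂ^n` of `GL(n)`. -/
def vecRep (n : ℕ) : Representation ℂ (GL (Fin n) ℂ) (Fin n → ℂ) where
  toFun g := Matrix.toLin' g.1
  map_one' := by rw [Units.val_one, Matrix.toLin'_one]; rfl
  map_mul' g h := by rw [Units.val_mul, Matrix.toLin'_mul]; rfl

variable (μ : YoungDiagram) (n : ℕ)

/-- The tensor power of `V` with one factor for each cell of `μ`. -/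
abbrev CellTensor : Type := ⨂[ℂ] _ : μ.cells, (Fin n → ℂ)

/-- The diagonal action of `GL(n)` on the tensor power. -/
def cellTensorRep : Representation ℂ (GL (Fin n) ℂ) (CellTensor μ n) where
  toFun g := PiTensorProduct.map fun _ => vecRep n g
  map_one' := by simp only [map_one]; exact PiTensorProduct.map_one
  map_mul' g h := by simp only [map_mul]; exact PiTensorProduct.map_mul _ _

/-- The action of a permutation of the cells on the tensor power, permuting the factors. -/
def permCells (σ : Equiv.Perm μ.cells) : CellTensor μ n →ₗ[ℂ] CellTensor μ n :=
  (PiTensorProduct.reindex ℂ (fun _ : μ.cells => (Fin n → ℂ)) σ).toLinearMap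

/-- The permutations of the cells that preserve each row. -/
def rowPerms : Finset (Equiv.Perm μ.cells) :=
  Finset.univ.filter fun σ => ∀ c, (σ c).1.1 = c.1.1

/-- The permutations of the cells that preserve each column. -/
def colPerms : Finset (Equiv.Perm μ.cells) :=
  Finset.univ.filter fun σ => ∀ c, (σ c).1.2 = c.1.2

/-- The Young symmetrizer of `μ`: antisymmetrization along the columns followed by symmetrization
along the rows. -/
def youngSymmetrizer : CellTensor μ n →ₗ[ℂ] CellTensor μ n :=
  (∑ σ ∈ rowPerms μ, permCells μ n σ) ∘ₗ
    (∑ τ ∈ colPerms μ, ((Equiv.Perm.sign τ : ℤ) : ℂ) • permCells μ n τ)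

theorem cellTensorRep_permCells (g : GL (Fin n) ℂ) (σ : Equiv.Perm μ.cells)
    (x : CellTensor μ n) :
    cellTensorRep μ n g (permCells μ n σ x) = permCells μ n σ (cellTensorRep μ n g x) := by
  suffices h : (cellTensorRep μ n g) ∘ₗ (permCells μ n σ)
      = (permCells μ n σ) ∘ₗ (cellTensorRep μ n g) from LinearMap.congr_fun h x
  refine PiTensorProduct.ext (MultilinearMap.ext fun v => ?_)
  simp [cellTensorRep, permCells, PiTensorProduct.reindex_tprod]

theorem cellTensorRep_youngSymmetrizer (g : GL (Fin n) ℂ) (x : CellTensor μ n) :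
    cellTensorRep μ n g (youngSymmetrizer μ n x)
      = youngSymmetrizer μ n (cellTensorRep μ n g x) := by
  simp only [youngSymmetrizer, LinearMap.comp_apply, LinearMap.sum_apply, LinearMap.smul_apply,
    map_sum, map_smul, cellTensorRep_permCells]

/-- The space of `F_μ`: the image of the Young symmetrizer of `μ` on the tensor power of `V`. -/
def SchurModule : Type := LinearMap.range (youngSymmetrizer μ n)

instance : AddCommGroup (SchurModule μ n) :=
  inferInstanceAs (AddCommGroup (LinearMap.range (youngSymmetrizer μ n)))

instance : Module ℂ (SchurModule μ n) :=
  inferInstanceAs (Module ℂ (LinearMap.range (youngSymmetrizer μ n)))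

theorem cellTensorRep_mem_range (g : GL (Fin n) ℂ) (x : CellTensor μ n)
    (hx : x ∈ LinearMap.range (youngSymmetrizer μ n)) :
    cellTensorRep μ n g x ∈ LinearMap.range (youngSymmetrizer μ n) := by
  obtain ⟨x, rfl⟩ := hx
  exact ⟨_, (cellTensorRep_youngSymmetrizer μ n g x).symm⟩

/-- `F_μ`, the polynomial representation of `GL(n)` with highest weight `μ` (Weyl's construction):
the image of the Young symmetrizer, as a subrepresentation of the tensor power of `V`. -/
def schurRep : Representation ℂ (GL (Fin n) ℂ) (SchurModule μ n) where
  toFun g := (cellTensorRep μ n g).restrict (p := LinearMap.range (youngSymmetrizer μ n))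
    (q := LinearMap.range (youngSymmetrizer μ n)) (cellTensorRep_mem_range μ n g)
  map_one' := LinearMap.ext fun x => Subtype.ext (by
    change cellTensorRep μ n 1 x.1 = x.1
    rw [map_one]; rfl)
  map_mul' g h := LinearMap.ext fun x => Subtype.ext (by
    change cellTensorRep μ n (g * h) x.1 = cellTensorRep μ n g (cellTensorRep μ n h x.1)
    rw [map_mul]; rfl)

/-- The Young diagram of the partition `(2, 1)`. -/
def diagram21 : YoungDiagram := YoungDiagram.ofRowLens [2, 1] (by decide)

/-- The Young diagram of the partition `(2, 2)`. -/
def diagram22 : YoungDiagram := YoungDiagram.ofRowLens [2, 2] (by decide)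

end Schur

end LieNilpotent

end

/-! Write T for the span in `D n 4` of the symbols of triple commutators [[u,v],w] of vectors, and P
for the span of the symbols of [a,c][b,d] + [a,d][b,c]. The kernel turns out to be T + P, with T a
copy of F_(2,1) and P a copy of F_(2,2).

T + P is an ideal in the kernel. In Q_4 all fourfold brackets vanish. Hence triple commutators are
central, commutators commute with each other, a triple commutator kills every commutator
(`lie_lie_mul_lie`), and so does [a,c][b,d] + [a,d][b,c] (`lie_mul_lie_add_mul_lie`). Modulo M_4 the
algebra ℓ_n' reduces to double and triple commutators of vectors (`mk_mem_of_mem_derivedLie`), so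
these identities say that every generator of Λ_4 annihilates T + P. Both spans die in D_3, because
Q_3 is Lie nilpotent of class 2.

The kernel is no larger. In Λ_4 / (T + P) the halved commutators satisfy the defining relations of
the even part of the exterior algebra of V, so that even part surjects onto the quotient. In the
other direction, x_i ↦ e_i s maps Q_3 to polynomials over the exterior algebra, and extracting top
coefficients gives a homomorphism out of D_3. The composite is the inclusion of the even part
(`evalOneExt_comp`), so Λ_4 / (T + P) embeds in D_3; this gives `mem_of_projD_eq_zero`.

Identifying T and P. Equivariant maps from tensors of shape (2,1) and (2,2) carry the images of the
Young symmetrizers onto T and P. They are injective there because the Schur modules are irreducible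
and the maps are nonzero. Nonvanishing is seen in two models of the free algebra: 2 × 2 matrices for
a triple commutator, the Weyl algebra for the square of a commutator. Finally T + P is direct, since
T has Lie degree one and P Lie degree two.

Irreducibility (`schurRep_isIrreducible`) is half of Schur–Weyl duality done by hand. By density of
the invertible matrices and polarization, a GL(n)-stable subspace is stable under symmetrized tensor
products of arbitrary matrices. Feeding in rank-one matrices and using the combinatorics of Young
symmetrizers recovers the whole module from any nonzero vector. -/

noncomputable section

namespace LieNilpotent

/-! ### Polarization of multilinear maps, and density of GL(n) in the matrices -/

section Polarization

variable {ι E W : Type*} [Fintype ι] [DecidableEq ι] [AddCommGroup E] [Module ℂ E]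
  [AddCommGroup W] [Module ℂ W]

/-- The signed number of finsets containing the range of a non-surjective map is zero. -/
theorem sum_neg_one_pow_card_of_not_surjective {f : ι → ι} (hf : ¬ Function.Surjective f) :
    ∑ S : Finset ι, (if ∀ i, f i ∈ S then (-1 : ℂ) ^ S.card else 0) = 0 := by
  obtain ⟨j, hj⟩ := not_forall.1 hf
  have hj' : ∀ i, f i ≠ j := fun i h => hj ⟨i, h⟩
  -- Adding or removing the missed value `j` changes the sign but not the condition on `S`, so the
  -- terms cancel in pairs.
  have hmem : ∀ (S : Finset ι), (∀ i, f i ∈ symmDiff S {j}) ↔ ∀ i, f i ∈ S := by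
    intro S
    refine forall_congr' fun i => ?_
    simp [Finset.mem_symmDiff, hj' i]
  refine Finset.sum_involution (fun S _ => symmDiff S {j}) ?_ ?_ ?_ ?_
  · intro S _
    simp only [hmem]
    split_ifs
    · by_cases h : j ∈ S
      · have : symmDiff S {j} = S.erase j := by
          ext x; by_cases hx : x = j <;> simp [Finset.mem_symmDiff, hx, h]
        rw [this, ← Finset.card_erase_add_one h, pow_succ]; ring
      · have : symmDiff S {j} = insert j S := by
          ext x; by_cases hx : x = j <;> simp [Finset.mem_symmDiff, hx, h]
        rw [this, Finset.card_insert_of_notMem h, pow_succ]; ring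
    · simp
  · intro S _ _ h
    have := congrArg (fun T => j ∈ T) h
    simp [Finset.mem_symmDiff] at this
  · intro S _; exact Finset.mem_univ _
  · intro S _; simp

/-- Polarization: a subspace containing the diagonal values of a multilinear map contains its
symmetrized values. -/
theorem sum_perm_mem_of_diagonal_mem (M : MultilinearMap ℂ (fun _ : ι => E) W)
    (U : Submodule ℂ W) (h : ∀ A : E, M (fun _ => A) ∈ U) (A : ι → E) :
    ∑ σ : Equiv.Perm ι, M (fun i => A (σ i)) ∈ U := by
  -- Inclusion–exclusion: expanding multilinearly, the coefficient of `M (A ∘ f)` is the signed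
  -- count of the sets containing the range of `f`. It vanishes unless `f` is a permutation, and
  -- then only the full set contributes.
  have key : ∑ S : Finset ι, (-1 : ℂ) ^ S.card • M (fun _ => ∑ j ∈ S, A j)
      = (-1 : ℂ) ^ Fintype.card ι • ∑ σ : Equiv.Perm ι, M (fun i => A (σ i)) := by
    have h1 : ∀ S : Finset ι, (-1 : ℂ) ^ S.card • M (fun _ => ∑ j ∈ S, A j)
        = ∑ f : ι → ι, (if ∀ i, f i ∈ S then (-1 : ℂ) ^ S.card else 0) • M (fun i => A (f i)) := by
      intro S
      rw [M.map_sum_finset (fun _ j => A j) (fun _ => S), Finset.smul_sum]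
      rw [← Finset.sum_subset (Finset.subset_univ (Fintype.piFinset fun _ => S))]
      · refine Finset.sum_congr rfl fun f hf => ?_
        rw [if_pos (Fintype.mem_piFinset.1 hf)]
      · intro f _ hf
        rw [if_neg (fun h => hf (Fintype.mem_piFinset.2 h)), zero_smul]
    simp_rw [h1]
    rw [Finset.sum_comm]
    simp_rw [← Finset.sum_smul]
    rw [Finset.smul_sum]
    rw [← Finset.sum_subset
      (Finset.subset_univ ((Finset.univ : Finset (Equiv.Perm ι)).map
        (⟨fun σ => ⇑σ, DFunLike.coe_injective⟩ : Equiv.Perm ι ↪ (ι → ι))))]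
    · rw [Finset.sum_map]
      refine Finset.sum_congr rfl fun σ _ => ?_
      congr 1
      rw [Finset.sum_eq_single Finset.univ]
      · simp
      · intro S _ hS
        rw [if_neg]
        intro h
        exact hS (Finset.eq_univ_of_forall fun j => by simpa using h (σ.symm j))
      · simp
    · intro f _ hf
      rw [sum_neg_one_pow_card_of_not_surjective, zero_smul]
      intro hs
      refine hf (Finset.mem_map.2 ⟨Equiv.ofBijective f
        ⟨Finite.injective_iff_surjective.2 hs, hs⟩, Finset.mem_univ _, rfl⟩)
  have hmem : (-1 : ℂ) ^ Fintype.card ι • ∑ σ : Equiv.Perm ι, M (fun i => A (σ i)) ∈ U := by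
    rw [← key]
    exact Submodule.sum_mem _ fun S _ => Submodule.smul_mem _ _ (h _)
  exact (Submodule.smul_mem_iff _ (pow_ne_zero _ (by norm_num))).1 hmem

/-- Density of the invertible matrices: a subspace containing the diagonal values of a multilinear
map at all invertible matrices contains the diagonal values at all matrices. -/
theorem diagonal_mem_of_forall_isUnit {n : ℕ}
    (M : MultilinearMap ℂ (fun _ : ι => Matrix (Fin n) (Fin n) ℂ) W)
    (U : Submodule ℂ W) (h : ∀ g : GL (Fin n) ℂ, M (fun _ => g.1) ∈ U)
    (A : Matrix (Fin n) (Fin n) ℂ) : M (fun _ => A) ∈ U := by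
  by_contra hA
  obtain ⟨ψ, hψ, hU⟩ := Submodule.exists_le_ker_of_notMem hA
  -- A functional vanishing on `U` turns `z ↦ M (A + z)` into a polynomial in `z`. It vanishes
  -- wherever `A + z` is invertible, that is, off the roots of the characteristic polynomial of
  -- `-A`; so it is zero, and its value at `z = 0` gives the contradiction.
  let p : ℂ[X] := ∑ S : Finset ι,
    Polynomial.C (ψ (M (S.piecewise (fun _ => A) fun _ => (1 : Matrix (Fin n) (Fin n) ℂ))))
      * Polynomial.X ^ (Sᶜ).card
  have hp : ∀ z : ℂ, p.eval z = ψ (M fun _ => A + z • (1 : Matrix (Fin n) (Fin n) ℂ)) := by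
    intro z
    have := M.map_add_univ (fun _ => A) (fun _ => z • (1 : Matrix (Fin n) (Fin n) ℂ))
    change M (fun _ => A + z • (1 : Matrix (Fin n) (Fin n) ℂ)) = _ at this
    rw [this, map_sum, Polynomial.eval_finsetSum]
    refine Finset.sum_congr rfl fun S _ => ?_
    have h2 : M (S.piecewise (fun _ => A) fun _ => z • (1 : Matrix (Fin n) (Fin n) ℂ))
        = z ^ (Sᶜ).card • M (S.piecewise (fun _ => A) fun _ => 1) := by
      have h3 := M.map_piecewise_smul (fun _ => z)
        (S.piecewise (fun _ => A) fun _ => (1 : Matrix (Fin n) (Fin n) ℂ)) Sᶜ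
      rw [Finset.prod_const] at h3
      rw [← h3]
      congr 1
      ext i : 1
      by_cases hi : i ∈ S <;> simp [hi]
    rw [h2]
    rw [map_smul, smul_eq_mul, Polynomial.eval_mul, Polynomial.eval_C, Polynomial.eval_pow,
      Polynomial.eval_X, mul_comm]
  have hz : ∀ z : ℂ, ¬ (Matrix.charpoly (-A)).IsRoot z → p.IsRoot z := by
    intro z hz
    have hdet : IsUnit (A + z • (1 : Matrix (Fin n) (Fin n) ℂ)) := by
      rw [Matrix.isUnit_iff_isUnit_det, isUnit_iff_ne_zero]
      intro h0
      apply hz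
      rw [Polynomial.IsRoot, Matrix.eval_charpoly, ← h0]
      congr 1
      rw [sub_neg_eq_add, add_comm, Matrix.scalar_apply, Matrix.smul_one_eq_diagonal]
    obtain ⟨g, hg⟩ := hdet
    rw [Polynomial.IsRoot, hp, ← hg]
    exact hU (h g)
  have hp0 : p = 0 := by
    by_contra hne
    have hfin : ((Matrix.charpoly (-A)).rootSet ℂ ∪ p.rootSet ℂ).Finite :=
      (Polynomial.rootSet_finite _ _).union (Polynomial.rootSet_finite _ _)
    obtain ⟨z, hzz⟩ := hfin.exists_notMem
    have hc : Matrix.charpoly (-A) ≠ 0 := (Matrix.charpoly_monic _).ne_zero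
    simp only [Set.mem_union, not_or, Polynomial.mem_rootSet, Polynomial.aeval_def,
      Algebra.algebraMap_self, Polynomial.eval₂_id] at hzz
    refine hzz.2 ⟨hne, hz z fun h => hzz.1 ⟨hc, h⟩⟩
  have := hp 0
  rw [hp0] at this
  simp at this
  exact hψ this.symm

end Polarization


/-! ### Young symmetrizers and irreducibility of the Schur modules -/

section Irreducible

variable (μ : YoungDiagram) (n : ℕ)

theorem permCells_tprod (σ : Equiv.Perm μ.cells) (v : μ.cells → Fin n → ℂ) :
    permCells μ n σ (PiTensorProduct.tprod ℂ v)
      = PiTensorProduct.tprod ℂ fun c => v (σ⁻¹ c) := by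
  simp [permCells, PiTensorProduct.reindex_tprod]

theorem permCells_mul_apply (σ τ : Equiv.Perm μ.cells) (x : CellTensor μ n) :
    permCells μ n (σ * τ) x = permCells μ n σ (permCells μ n τ x) := by
  suffices h : permCells μ n (σ * τ) = permCells μ n σ ∘ₗ permCells μ n τ from
    LinearMap.congr_fun h x
  refine PiTensorProduct.ext (MultilinearMap.ext fun v => ?_)
  simp [permCells_tprod]

/-- The sum of the permutations in the row group. -/
def rowSum : CellTensor μ n →ₗ[ℂ] CellTensor μ n := ∑ σ ∈ rowPerms μ, permCells μ n σ

/-- The signed sum of the permutations in the column group. -/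
def colSum : CellTensor μ n →ₗ[ℂ] CellTensor μ n :=
  ∑ τ ∈ colPerms μ, ((Equiv.Perm.sign τ : ℤ) : ℂ) • permCells μ n τ

theorem youngSymmetrizer_apply (x : CellTensor μ n) :
    youngSymmetrizer μ n x = rowSum μ n (colSum μ n x) := rfl

variable {μ} in
theorem mul_mem_rowPerms {σ τ : Equiv.Perm μ.cells} (hσ : σ ∈ rowPerms μ) (hτ : τ ∈ rowPerms μ) :
    σ * τ ∈ rowPerms μ := by
  simp only [rowPerms, Finset.mem_filter, Finset.mem_univ, true_and] at *
  intro c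
  rw [Equiv.Perm.mul_apply, hσ, hτ]

variable {μ} in
theorem inv_mem_rowPerms {σ : Equiv.Perm μ.cells} (hσ : σ ∈ rowPerms μ) : σ⁻¹ ∈ rowPerms μ := by
  simp only [rowPerms, Finset.mem_filter, Finset.mem_univ, true_and] at *
  intro c
  rw [← hσ, ← Equiv.Perm.mul_apply, mul_inv_cancel, Equiv.Perm.one_apply]

variable {μ} in
theorem mul_mem_colPerms {σ τ : Equiv.Perm μ.cells} (hσ : σ ∈ colPerms μ) (hτ : τ ∈ colPerms μ) :
    σ * τ ∈ colPerms μ := by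
  simp only [colPerms, Finset.mem_filter, Finset.mem_univ, true_and] at *
  intro c
  rw [Equiv.Perm.mul_apply, hσ, hτ]

variable {μ} in
theorem inv_mem_colPerms {σ : Equiv.Perm μ.cells} (hσ : σ ∈ colPerms μ) : σ⁻¹ ∈ colPerms μ := by
  simp only [colPerms, Finset.mem_filter, Finset.mem_univ, true_and] at *
  intro c
  rw [← hσ, ← Equiv.Perm.mul_apply, mul_inv_cancel, Equiv.Perm.one_apply]

variable {μ} in
theorem rowSum_permCells {ρ : Equiv.Perm μ.cells} (hρ : ρ ∈ rowPerms μ) (x : CellTensor μ n) :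
    rowSum μ n (permCells μ n ρ x) = rowSum μ n x := by
  simp only [rowSum, LinearMap.sum_apply, ← permCells_mul_apply]
  refine Finset.sum_bij' (fun σ _ => σ * ρ) (fun σ _ => σ * ρ⁻¹) ?_ ?_ ?_ ?_ ?_
  · exact fun σ hσ => mul_mem_rowPerms hσ hρ
  · exact fun σ hσ => mul_mem_rowPerms hσ (inv_mem_rowPerms hρ)
  all_goals simp

variable {μ} in
theorem permCells_rowSum {ρ : Equiv.Perm μ.cells} (hρ : ρ ∈ rowPerms μ) (x : CellTensor μ n) :
    permCells μ n ρ (rowSum μ n x) = rowSum μ n x := by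
  simp only [rowSum, LinearMap.sum_apply, map_sum, ← permCells_mul_apply]
  refine Finset.sum_bij' (fun σ _ => ρ * σ) (fun σ _ => ρ⁻¹ * σ) ?_ ?_ ?_ ?_ ?_
  · exact fun σ hσ => mul_mem_rowPerms hρ hσ
  · exact fun σ hσ => mul_mem_rowPerms (inv_mem_rowPerms hρ) hσ
  all_goals simp

variable {μ} in
theorem permCells_colSum {τ : Equiv.Perm μ.cells} (hτ : τ ∈ colPerms μ) (x : CellTensor μ n) :
    permCells μ n τ (colSum μ n x) = ((Equiv.Perm.sign τ : ℤ) : ℂ) • colSum μ n x := by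
  simp only [colSum, LinearMap.sum_apply, LinearMap.smul_apply, map_sum, map_smul,
    ← permCells_mul_apply, Finset.smul_sum]
  refine Finset.sum_bij' (fun σ _ => τ * σ) (fun σ _ => τ⁻¹ * σ) ?_ ?_ ?_ ?_ ?_
  · exact fun σ hσ => mul_mem_colPerms hτ hσ
  · exact fun σ hσ => mul_mem_colPerms (inv_mem_colPerms hτ) hσ
  · simp
  · simp
  · intro σ _
    rw [smul_smul]
    congr 1
    rcases Int.units_eq_one_or (Equiv.Perm.sign τ) with h | h <;> simp [h]

/-- The coefficient of `σ` in the Young symmetrizer. -/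
def youngCoeff (σ : Equiv.Perm μ.cells) : ℤ :=
  ∑ ρ ∈ rowPerms μ, ∑ τ ∈ colPerms μ, if ρ * τ = σ then (Equiv.Perm.sign τ : ℤ) else 0

/-- Von Neumann's dichotomy: a permutation either factors as a row permutation times a column
permutation, or conjugates some odd column permutation into the row group. -/
def VonNeumann : Prop :=
  ∀ σ : Equiv.Perm μ.cells,
    (∃ ρ ∈ rowPerms μ, ρ⁻¹ * σ ∈ colPerms μ ∧
      youngCoeff μ σ = (Equiv.Perm.sign (ρ⁻¹ * σ) : ℤ)) ∨
    (youngCoeff μ σ = 0 ∧ ∃ τ ∈ colPerms μ, Equiv.Perm.sign τ = -1 ∧ σ * τ * σ⁻¹ ∈ rowPerms μ)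

instance : Decidable (VonNeumann μ) :=
  inferInstanceAs (Decidable (∀ σ : Equiv.Perm μ.cells,
    (∃ ρ ∈ rowPerms μ, ρ⁻¹ * σ ∈ colPerms μ ∧
      youngCoeff μ σ = (Equiv.Perm.sign (ρ⁻¹ * σ) : ℤ)) ∨
    (youngCoeff μ σ = 0 ∧ ∃ τ ∈ colPerms μ, Equiv.Perm.sign τ = -1 ∧ σ * τ * σ⁻¹ ∈ rowPerms μ)))

/-- The scalar by which the square of the Young symmetrizer differs from the symmetrizer. -/
def hookProduct : ℤ :=
  ∑ τ ∈ colPerms μ, ∑ ρ ∈ rowPerms μ, (Equiv.Perm.sign τ : ℤ) * youngCoeff μ (τ * ρ)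

/-- A finite check over the 3! permutations of the cells; for the next diagram over 4!. -/
theorem vonNeumann_diagram21 : VonNeumann diagram21 := by decide +kernel
theorem vonNeumann_diagram22 : VonNeumann diagram22 := by decide +kernel
-- The scalars are |μ|! divided by the number of standard tableaux: 6/2 here and 24/2 for (2,2).
theorem hookProduct_diagram21 : hookProduct diagram21 = 3 := by decide +kernel
theorem hookProduct_diagram22 : hookProduct diagram22 = 12 := by decide +kernel

variable {μ}

/-- If `σ = ρ * τ`, the row sum absorbs `ρ` and the column sum turns `τ` into its sign. Otherwise an
odd column permutation can be moved across `σ` into the row group, so the left side equals its own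
negative. This replaces every operator sandwiched between the two sums by a scalar. -/
theorem rowSum_permCells_colSum (h : VonNeumann μ) (σ : Equiv.Perm μ.cells)
    (x : CellTensor μ n) :
    rowSum μ n (permCells μ n σ (colSum μ n x))
      = (youngCoeff μ σ : ℂ) • youngSymmetrizer μ n x := by
  rw [youngSymmetrizer_apply]
  rcases h σ with ⟨ρ, hρ, hτ, hc⟩ | ⟨hc, τ, hτ, hs, hρ⟩
  · have : σ = ρ * (ρ⁻¹ * σ) := by group
    rw [hc]
    conv_lhs => rw [this]
    rw [permCells_mul_apply, rowSum_permCells n hρ, permCells_colSum n hτ, map_smul]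
  · rw [hc, Int.cast_zero, zero_smul]
    have h1 : rowSum μ n (permCells μ n σ (permCells μ n τ (colSum μ n x)))
        = rowSum μ n (permCells μ n σ (colSum μ n x)) := by
      rw [← permCells_mul_apply, show σ * τ = (σ * τ * σ⁻¹) * σ by group, permCells_mul_apply,
        rowSum_permCells n hρ]
    rw [permCells_colSum n hτ, hs, map_smul, map_smul] at h1
    generalize rowSum μ n (permCells μ n σ (colSum μ n x)) = y at h1
    have h2 : (2 : ℂ) • y = 0 := by
      rw [show (2 : ℂ) = 1 + 1 by norm_num, add_smul, one_smul]
      nth_rewrite 1 [← h1]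
      nth_rewrite 2 [← one_smul ℂ y]
      rw [← add_smul]
      simp
    exact (smul_eq_zero.1 h2).resolve_left two_ne_zero

theorem youngSymmetrizer_sq (h : VonNeumann μ) (x : CellTensor μ n) :
    youngSymmetrizer μ n (youngSymmetrizer μ n x)
      = (hookProduct μ : ℂ) • youngSymmetrizer μ n x := by
  -- Expanding the two inner sums leaves an outer row sum and an inner column sum with `τ * ρ`
  -- sandwiched between them.
  have h1 : youngSymmetrizer μ n (youngSymmetrizer μ n x)
      = ∑ τ ∈ colPerms μ, ∑ ρ ∈ rowPerms μ, ((Equiv.Perm.sign τ : ℤ) : ℂ) •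
        rowSum μ n (permCells μ n (τ * ρ) (colSum μ n x)) := by
    rw [youngSymmetrizer_apply μ n (youngSymmetrizer μ n x), youngSymmetrizer_apply, colSum,
      LinearMap.sum_apply, map_sum]
    refine Finset.sum_congr rfl fun τ _ => ?_
    rw [LinearMap.smul_apply, map_smul, ← Finset.smul_sum]
    congr 1
    rw [← map_sum]
    congr 1
    simp only [permCells_mul_apply, ← map_sum]
    rw [rowSum, LinearMap.sum_apply]
  rw [h1, hookProduct]
  push_cast
  simp only [Finset.sum_smul, rowSum_permCells_colSum n h, smul_smul]

/-- The operator `∑_σ φ(σ x) σ⁻¹ t` lies in every `GL(n)`-stable subspace containing `x`, when `φ`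
is a product of coordinate functionals. -/
theorem sum_coord_smul_mem (U : Submodule ℂ (CellTensor μ n))
    (hU : ∀ g, ∀ x ∈ U, cellTensorRep μ n g x ∈ U) {x : CellTensor μ n} (hx : x ∈ U)
    (q : μ.cells → Fin n) (t : CellTensor μ n) :
    ∑ σ : Equiv.Perm μ.cells,
      (Basis.piTensorProduct fun _ : μ.cells => Pi.basisFun ℂ (Fin n)).coord q (permCells μ n σ x) •
        permCells μ n σ⁻¹ t ∈ U := by
  induction t using PiTensorProduct.induction_on with
  | add a b ha hb =>
    simp only [map_add, smul_add, Finset.sum_add_distrib]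
    exact add_mem ha hb
  | smul_tprod r t =>
    let M : MultilinearMap ℂ (fun _ : μ.cells => Matrix (Fin n) (Fin n) ℂ) (CellTensor μ n) :=
      ((LinearMap.applyₗ x).compMultilinearMap
        (PiTensorProduct.mapMultilinear ℂ (fun _ : μ.cells => Fin n → ℂ)
          (fun _ : μ.cells => Fin n → ℂ))).compLinearMap fun _ => Matrix.toLin'.toLinearMap
    have hM : ∀ A, M A = PiTensorProduct.map (fun i => Matrix.toLin' (A i)) x := fun A => rfl
    have h := sum_perm_mem_of_diagonal_mem M U
      (diagonal_mem_of_forall_isUnit M U fun g => hU g x hx)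
      -- The rank-one matrix sends `v` to `v (q i) • t i`. The symmetrized tensor product of these
      -- matrices is then a sum of coordinates of permutations of `x` times permutations of `t`.
      (fun i => Matrix.vecMulVec (t i) (Pi.single (q i) 1))
    simp only [map_smul, smul_comm _ r, ← Finset.smul_sum]
    refine Submodule.smul_mem _ _ ?_
    convert h using 2 with σ
    rw [hM, permCells_tprod]
    clear hM M h hx
    induction x using PiTensorProduct.induction_on with
    | add a b ha hb => simp only [map_add, add_smul, ha, hb]
    | smul_tprod s v =>
      simp only [map_smul, smul_assoc]
      congr 1
      rw [permCells_tprod, PiTensorProduct.map_tprod, Module.Basis.coord_apply,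
        Basis.piTensorProduct_repr_tprod_apply]
      have : ∀ i, Matrix.toLin' (Matrix.vecMulVec (t (σ i)) (Pi.single (q (σ i)) 1)) (v i)
          = v i (q (σ i)) • t (σ i) := by
        intro i
        ext j
        simp [Matrix.vecMulVec_mulVec, mul_comm]
      simp only [this]
      rw [MultilinearMap.map_smul_univ]
      congr 1
      exact Fintype.prod_equiv σ⁻¹ _ _ fun i => by simp

/-- `F_μ` is irreducible if it is nonzero. -/
theorem schurRep_isIrreducible (h : VonNeumann μ) (hk : hookProduct μ ≠ 0)
    (h0 : ∃ t, youngSymmetrizer μ n t ≠ 0) : (schurRep μ n).IsIrreducible := by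
  have key : ∀ S : Subrepresentation (schurRep μ n), S ≠ ⊥ → S = ⊤ := by
    intro S hS
    obtain ⟨u, huS, hu0⟩ : ∃ u ∈ S.toSubmodule, u ≠ 0 := by
      by_contra! hc
      exact hS (Subrepresentation.toSubmodule_injective ((Submodule.eq_bot_iff _).2 hc))
    let ι : SchurModule μ n →ₗ[ℂ] CellTensor μ n :=
      (LinearMap.range (youngSymmetrizer μ n)).subtype
    have hι : Function.Injective ι := Subtype.val_injective
    let U : Submodule ℂ (CellTensor μ n) := S.toSubmodule.map ι
    have hU : ∀ g, ∀ x ∈ U, cellTensorRep μ n g x ∈ U := by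
      rintro g _ ⟨y, hy, rfl⟩
      exact ⟨_, S.apply_mem_toSubmodule g hy, rfl⟩
    have huU : ι u ∈ U := ⟨u, huS, rfl⟩
    obtain ⟨w, hw⟩ : ∃ w, youngSymmetrizer μ n w = ι u := u.2
    -- As `u` lies in the image of the symmetrizer, the symmetrizer multiplies it by the nonzero
    -- `hookProduct μ`; its column sum therefore cannot vanish.
    have hcol : colSum μ n (ι u) ≠ 0 := by
      intro hc
      apply hu0
      apply hι
      have h2 : youngSymmetrizer μ n (ι u) = 0 := by rw [youngSymmetrizer_apply, hc, map_zero]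
      rw [← hw, youngSymmetrizer_sq n h, hw] at h2
      rw [map_zero]
      exact (smul_eq_zero.1 h2).resolve_left (by exact_mod_cast hk)
    have hrow : ∀ ρ ∈ rowPerms μ, permCells μ n ρ (ι u) = ι u := fun ρ hρ => by
      rw [← hw, youngSymmetrizer_apply, permCells_rowSum n hρ]
    let b := Basis.piTensorProduct fun _ : μ.cells => Pi.basisFun ℂ (Fin n)
    obtain ⟨q, hq⟩ : ∃ q, b.coord q (colSum μ n (ι u)) ≠ 0 := by
      by_contra! hc
      exact hcol (b.ext_elem fun q => by simpa using hc q)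
    let x (t : CellTensor μ n) : CellTensor μ n := ∑ σ : Equiv.Perm μ.cells,
      b.coord q (permCells μ n σ (ι u)) • permCells μ n σ⁻¹ t
    have hxU : ∀ t, x t ∈ U := sum_coord_smul_mem n U hU huU q
    have hxrow : ∀ t, ∀ ρ ∈ rowPerms μ, permCells μ n ρ (x t) = x t := by
      intro t ρ hρ
      simp only [x, map_sum, map_smul, ← permCells_mul_apply]
      refine Fintype.sum_equiv (Equiv.mulRight ρ⁻¹) _ _ fun σ => ?_
      rw [Equiv.coe_mulRight, permCells_mul_apply μ n σ ρ⁻¹ (ι u),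
        hrow _ (inv_mem_rowPerms hρ), mul_inv_rev, inv_inv]
    -- Each `σ⁻¹` contributes its Young coefficient. Expanding that coefficient over pairs `(ρ, τ)`,
    -- row invariance of `u` makes the sum over `ρ` a count, and the sum over `τ` rebuilds `colSum`
    -- of `u`.
    have hx : ∀ t, rowSum μ n (x (colSum μ n t))
        = ((rowPerms μ).card * b.coord q (colSum μ n (ι u)) : ℂ) • youngSymmetrizer μ n t := by
      intro t
      simp only [x, map_sum, map_smul, rowSum_permCells_colSum n h, smul_smul, ← Finset.sum_smul]
      congr 1
      have h1 : (rowPerms μ).card • colSum μ n (ι u)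
          = ∑ ρ ∈ rowPerms μ, ∑ τ ∈ colPerms μ,
            ((Equiv.Perm.sign τ : ℤ) : ℂ) • permCells μ n (ρ * τ)⁻¹ (ι u) := by
        rw [← Finset.sum_const]
        refine Finset.sum_congr rfl fun ρ hρ => ?_
        simp only [mul_inv_rev, permCells_mul_apply, hrow _ (inv_mem_rowPerms hρ)]
        simp only [colSum, LinearMap.sum_apply, LinearMap.smul_apply]
        refine Finset.sum_bij' (fun τ _ => τ⁻¹) (fun τ _ => τ⁻¹) (fun τ => inv_mem_colPerms)
          (fun τ => inv_mem_colPerms) ?_ ?_ ?_ <;> simp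
      have h2 := congrArg (b.coord q) h1
      rw [map_nsmul, nsmul_eq_mul] at h2
      rw [h2]
      simp only [map_sum, map_smul, smul_eq_mul, youngCoeff, Int.cast_sum, Finset.mul_sum]
      rw [← Equiv.sum_comp (Equiv.inv (Equiv.Perm μ.cells)), Finset.sum_comm]
      refine Finset.sum_congr rfl fun ρ _ => ?_
      rw [Finset.sum_comm]
      refine Finset.sum_congr rfl fun τ _ => ?_
      rw [Finset.sum_eq_single (ρ * τ)]
      · simp [mul_comm]
      · intro σ _ hσ
        simp [Ne.symm hσ]
      · simp
    -- Since `x _` is row invariant, its row sum is a multiple of an element of `U`, although `U` is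
    -- not assumed stable under permutations.
    have hall : ∀ t, youngSymmetrizer μ n t ∈ U := by
      intro t
      have h1 : rowSum μ n (x (colSum μ n t)) ∈ U := by
        rw [rowSum, LinearMap.sum_apply]
        refine Submodule.sum_mem _ fun ρ hρ => ?_
        rw [hxrow _ ρ hρ]
        exact hxU _
      rw [hx] at h1
      refine (Submodule.smul_mem_iff _ (mul_ne_zero ?_ hq)).1 h1
      have : (1 : Equiv.Perm μ.cells) ∈ rowPerms μ := by simp [rowPerms]
      exact Nat.cast_ne_zero.2 (Finset.card_ne_zero_of_mem this)
    refine Subrepresentation.toSubmodule_injective (eq_top_iff.2 fun y _ => ?_)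
    obtain ⟨w', hw'⟩ : ∃ w, youngSymmetrizer μ n w = ι y := y.2
    obtain ⟨z, hz, hzy⟩ := hw' ▸ hall w'
    exact hι hzy ▸ hz
  obtain ⟨t, ht⟩ := h0
  have hne : (⊥ : Subrepresentation (schurRep μ n)) ≠ ⊤ := by
    intro hbt
    let y : SchurModule μ n := ⟨youngSymmetrizer μ n t, t, rfl⟩
    have hmem : y ∈ (⊥ : Subrepresentation (schurRep μ n)).toSubmodule := by
      rw [hbt]; exact Submodule.mem_top
    have hy : y = 0 := (Submodule.mem_bot ℂ).1 hmem
    exact ht (congrArg Subtype.val hy)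
  have : Nontrivial (Subrepresentation (schurRep μ n)) := ⟨⊥, ⊤, hne⟩
  exact ⟨fun S => or_iff_not_imp_left.2 (key S)⟩

end Irreducible


/-! ### Commutator identities in Lie nilpotent rings of class 2 and 3 -/

section Identities

attribute [local instance] LieRing.ofAssociativeRing

variable {R : Type*} [Ring R]

theorem comm_of_lie_eq_zero {x y : R} (h : ⁅x, y⁆ = 0) : x * y = y * x := by
  rwa [LieRing.of_associative_ring_bracket, sub_eq_zero] at h

/-- In a Lie nilpotent ring of class 2, `[a,c][a',b] + [a,b][a',c] = 0`. -/
theorem lie_mul_lie_add_eq_zero (h : ∀ a b c : R, ⁅a, ⁅b, c⁆⁆ = 0) (a b c d : R) :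
    ⁅a, c⁆ * ⁅b, d⁆ + ⁅a, d⁆ * ⁅b, c⁆ = 0 := by
  have h1 := h c (a * b) d
  have h2 := h c a d
  have h3 := h c b d
  simp only [LieRing.of_associative_ring_bracket] at *
  linear_combination (norm := noncomm_ring) -h1 + a * h3 + h2 * b

variable (h : ∀ a b c d : R, ⁅a, ⁅b, ⁅c, d⁆⁆⁆ = 0)
include h

theorem lie_lie_comm (a b c x : R) : ⁅⁅a, b⁆, c⁆ * x = x * ⁅⁅a, b⁆, c⁆ := by
  refine (comm_of_lie_eq_zero ?_).symm
  rw [← lie_skew ⁅a, b⁆ c, lie_neg, h, neg_zero]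

theorem lie_lie_lie_eq_zero (a b c d : R) : ⁅⁅a, b⁆, ⁅c, d⁆⁆ = 0 := by
  rw [lie_lie, h, h, sub_zero]

theorem lie_mul_lie_comm (a b c d : R) : ⁅a, b⁆ * ⁅c, d⁆ = ⁅c, d⁆ * ⁅a, b⁆ :=
  comm_of_lie_eq_zero (lie_lie_lie_eq_zero h a b c d)

/-- The triple commutator `⁅⁅a, b⁆, d * c⁆` is central. Expanding it by the Leibniz rule and
commuting with `e` leaves exactly the two products. -/
theorem lie_lie_mul_lie_swap (a b c d e : R) :
    ⁅⁅a, b⁆, c⁆ * ⁅d, e⁆ = -(⁅⁅a, b⁆, d⁆ * ⁅c, e⁆) := by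
  have h1 := lie_lie_comm h a b (d * c) e
  have h2 : ⁅⁅a, b⁆, d * c⁆ = d * ⁅⁅a, b⁆, c⁆ + ⁅⁅a, b⁆, d⁆ * c := by
    simp only [LieRing.of_associative_ring_bracket]; noncomm_ring
  rw [h2] at h1
  have h3 := lie_lie_comm h a b c
  have h4 := lie_lie_comm h a b d
  generalize ⁅⁅a, b⁆, c⁆ = z at *
  generalize ⁅⁅a, b⁆, d⁆ = w at *
  simp only [LieRing.of_associative_ring_bracket]
  linear_combination (norm := noncomm_ring) h1 + h3 (d * e) - h3 (e * d) + d * (- h3 e) - h4 e * c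

theorem lie_lie_mul_lie_swap' (a b c d e : R) :
    ⁅⁅a, b⁆, c⁆ * ⁅d, e⁆ = -(⁅⁅a, b⁆, e⁆ * ⁅d, c⁆) := by
  rw [← lie_skew d e, mul_neg, lie_lie_mul_lie_swap h, ← lie_skew d c, mul_neg, neg_neg]

/-- The same device with a product in the innermost slot: `⁅⁅a * a', b⁆, c⁆` commutes with `d`. Of
the six products in the expansion, four cancel by `lie_lie_mul_lie_swap'`. -/
theorem lie_lie_mul_lie_swap_left (a a' b c d : R) :
    ⁅⁅a, c⁆, d⁆ * ⁅a', b⁆ = -(⁅⁅a', c⁆, d⁆ * ⁅a, b⁆) := by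
  have h1 := lie_lie_comm h (a * a') b c d
  have h2 : ⁅⁅a * a', b⁆, c⁆ = a * ⁅⁅a', b⁆, c⁆ + ⁅a, c⁆ * ⁅a', b⁆ + ⁅a, b⁆ * ⁅a', c⁆
      + ⁅⁅a, b⁆, c⁆ * a' := by
    simp only [LieRing.of_associative_ring_bracket]; noncomm_ring
  have h3 : ⁅⁅a * a', b⁆, c⁆ * d - d * ⁅⁅a * a', b⁆, c⁆ =
      ⁅⁅a', b⁆, c⁆ * ⁅a, d⁆ + ⁅⁅a, b⁆, c⁆ * ⁅a', d⁆ + ⁅⁅a, c⁆, d⁆ * ⁅a', b⁆ + ⁅⁅a', b⁆, d⁆ * ⁅a, c⁆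
      + ⁅⁅a, b⁆, d⁆ * ⁅a', c⁆ + ⁅⁅a', c⁆, d⁆ * ⁅a, b⁆ := by
    have e1 := lie_lie_comm h a' b c
    have e2 := lie_lie_comm h a b c d
    have e3 := lie_lie_comm h a' b d ⁅a, c⁆
    have e4 := lie_lie_comm h a' c d ⁅a, b⁆
    have e5 : ∀ p q : R, p * q * d - d * (p * q) = p * ⁅q, d⁆ + ⁅p, d⁆ * q := by
      intro p q
      simp only [LieRing.of_associative_ring_bracket]; noncomm_ring
    have e6 : ∀ p q r s : R, (p + q + r + s) * d - d * (p + q + r + s) =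
      (p * d - d * p) + (q * d - d * q) + (r * d - d * r) + (s * d - d * s) := by
      intros; noncomm_ring
    have e7 : ∀ x y z: R, ⁅⁅⁅x, y⁆, z⁆, d⁆ = 0 := fun x y z => by
      rw [LieRing.of_associative_ring_bracket, lie_lie_comm h, sub_self]
    rw [h2, e6, e5, e5, e5, e5, e7, e7, e3, e4, e1 ⁅a, d⁆]
    simp only [mul_zero, zero_mul, add_zero, zero_add]
    abel
  rw [h1, sub_self] at h3
  rw [lie_lie_mul_lie_swap' h a' b c a d, lie_lie_mul_lie_swap' h a b c a' d] at h3
  rw [eq_neg_iff_add_eq_zero, h3]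
  abel

/-- Over `ℂ`, a triple commutator annihilates all commutators in a Lie nilpotent ring of class 3. -/
theorem lie_lie_mul_lie [Algebra ℂ R] (a b c d e : R) : ⁅⁅a, b⁆, c⁆ * ⁅d, e⁆ = 0 := by
  have jac : ⁅⁅a, b⁆, c⁆ + ⁅⁅b, c⁆, a⁆ + ⁅⁅c, a⁆, b⁆ = 0 := by
    simp only [LieRing.of_associative_ring_bracket]; noncomm_ring
  have jac' := congrArg (· * ⁅d, e⁆) jac
  simp only [add_mul, zero_mul] at jac'
  -- Three exchanges through the slot `d` amount to an antisymmetry in `x` and `z`, which with the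
  -- antisymmetry of the inner bracket gives cyclic invariance. The Jacobi identity then says that
  -- three times the product is zero.
  have cyc : ∀ x y z : R, ⁅⁅x, y⁆, z⁆ * ⁅d, e⁆ = ⁅⁅y, z⁆, x⁆ * ⁅d, e⁆ := by
    intro x y z
    have s1 : ⁅⁅x, y⁆, z⁆ * ⁅d, e⁆ = -(⁅⁅z, y⁆, x⁆ * ⁅d, e⁆) := by
      rw [lie_lie_mul_lie_swap h x y z d e, lie_lie_mul_lie_swap_left h x z e y d, neg_neg,
        lie_lie_mul_lie_swap h z y d x e]
    rw [s1, ← lie_skew y z, neg_lie, neg_mul]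
  rw [← cyc b c a, ← cyc a b c] at jac'
  have h3 : (3 : ℂ) • (⁅⁅a, b⁆, c⁆ * ⁅d, e⁆) = 0 := by
    rw [← jac', show (3 : ℂ) = 1 + 1 + 1 by norm_num, add_smul, add_smul, one_smul]
  exact (smul_eq_zero.1 h3).resolve_left (by norm_num)

/-- Expand `⁅⁅a * b, d⁆, c⁆`, which annihilates `⁅e, f⁆` by `lie_lie_mul_lie`: the terms containing
triple commutators die, and the sum of products of two commutators remains. -/
theorem lie_mul_lie_add_mul_lie [Algebra ℂ R] (a b c d e f : R) :
    (⁅a, c⁆ * ⁅b, d⁆ + ⁅a, d⁆ * ⁅b, c⁆) * ⁅e, f⁆ = 0 := by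
  have h1 := lie_lie_mul_lie h (a * b) d c e f
  have h2 : ⁅⁅a * b, d⁆, c⁆ = a * ⁅⁅b, d⁆, c⁆ + ⁅a, c⁆ * ⁅b, d⁆ + ⁅a, d⁆ * ⁅b, c⁆
      + ⁅⁅a, d⁆, c⁆ * b := by
    simp only [LieRing.of_associative_ring_bracket]; noncomm_ring
  rw [h2] at h1
  have h3 := lie_lie_mul_lie h b d c e f
  have h4 := lie_lie_mul_lie h a d c e f
  have h5 := lie_lie_comm h a d c b
  rw [h5] at h1
  have h6 : (⁅a, c⁆ * ⁅b, d⁆ + ⁅a, d⁆ * ⁅b, c⁆) * ⁅e, f⁆ =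
    (a * ⁅⁅b, d⁆, c⁆ + ⁅a, c⁆ * ⁅b, d⁆ + ⁅a, d⁆ * ⁅b, c⁆ + b * ⁅⁅a, d⁆, c⁆) * ⁅e, f⁆
      - a * (⁅⁅b, d⁆, c⁆ * ⁅e, f⁆) - b * (⁅⁅a, d⁆, c⁆ * ⁅e, f⁆) := by
    simp only [add_mul, mul_assoc]; abel
  rw [h6, h1, h3, h4]; simp

end Identities

/-! ### Lie nilpotency of Q_3 and Q_4, and a criterion for containing M_3 or M_4 -/

section Quotients

attribute [local instance] LieRing.ofAssociativeRing

variable {A : Type*} [Ring A] [Algebra ℂ A]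

theorem lie_lie_mem_lowerCentral (a b c : A) : ⁅a, ⁅b, c⁆⁆ ∈ lowerCentral A 3 := by
  change _ ∈ LieModule.lowerCentralSeries ℂ A A (1 + 1)
  rw [LieModule.lowerCentralSeries_succ, LieModule.lowerCentralSeries_succ]
  exact LieSubmodule.lie_mem_lie (LieSubmodule.mem_top _)
    (LieSubmodule.lie_mem_lie (LieSubmodule.mem_top _) (LieSubmodule.mem_top _))

theorem lie_lie_lie_mem_lowerCentral (a b c d : A) :
    ⁅a, ⁅b, ⁅c, d⁆⁆⁆ ∈ lowerCentral A 4 := by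
  change _ ∈ LieModule.lowerCentralSeries ℂ A A (2 + 1)
  rw [LieModule.lowerCentralSeries_succ]
  exact LieSubmodule.lie_mem_lie (LieSubmodule.mem_top _) (lie_lie_mem_lowerCentral b c d)

theorem Q.mk_lie (i : ℕ) (a b : A) : Q.mk A i ⁅a, b⁆ = ⁅Q.mk A i a, Q.mk A i b⁆ := by
  simp only [LieRing.of_associative_ring_bracket, map_sub, map_mul]

theorem Q_three_lie_lie (a b c : Q A 3) : ⁅a, ⁅b, c⁆⁆ = 0 := by
  obtain ⟨a, rfl⟩ := Q.mk_surjective 3 a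
  obtain ⟨b, rfl⟩ := Q.mk_surjective 3 b
  obtain ⟨c, rfl⟩ := Q.mk_surjective 3 c
  rw [← Q.mk_lie, ← Q.mk_lie, Q.mk_eq_zero]
  exact TwoSidedIdeal.subset_span (lie_lie_mem_lowerCentral a b c)

theorem Q_four_lie_lie_lie (a b c d : Q A 4) : ⁅a, ⁅b, ⁅c, d⁆⁆⁆ = 0 := by
  obtain ⟨a, rfl⟩ := Q.mk_surjective 4 a
  obtain ⟨b, rfl⟩ := Q.mk_surjective 4 b
  obtain ⟨c, rfl⟩ := Q.mk_surjective 4 c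
  obtain ⟨d, rfl⟩ := Q.mk_surjective 4 d
  rw [← Q.mk_lie, ← Q.mk_lie, ← Q.mk_lie, Q.mk_eq_zero]
  exact TwoSidedIdeal.subset_span (lie_lie_lie_mem_lowerCentral a b c d)

/-- A two-sided ideal containing all triple commutators contains `M_3`. -/
theorem idealM_three_le {J : TwoSidedIdeal A} (hJ : ∀ a b c : A, ⁅a, ⁅b, c⁆⁆ ∈ J) :
    idealM A 3 ≤ J := by
  refine TwoSidedIdeal.span_le.2 ?_
  suffices h : (lowerCentral A 3).toSubmodule ≤ J.asIdeal.restrictScalars ℂ by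
    intro x hx
    exact TwoSidedIdeal.mem_asIdeal.1 (h hx)
  change (LieModule.lowerCentralSeries ℂ A A (1 + 1)).toSubmodule ≤ _
  rw [LieModule.lowerCentralSeries_succ, LieSubmodule.lieIdeal_oper_eq_linear_span',
    Submodule.span_le]
  rintro _ ⟨a, _, y, hy, rfl⟩
  suffices h : (LieModule.lowerCentralSeries ℂ A A (0 + 1)).toSubmodule
      ≤ (J.asIdeal.restrictScalars ℂ).comap (LieModule.toEnd ℂ A A a) from h hy
  rw [LieModule.lowerCentralSeries_succ, LieSubmodule.lieIdeal_oper_eq_linear_span',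
    Submodule.span_le]
  rintro _ ⟨b, _, c, _, rfl⟩
  exact TwoSidedIdeal.mem_asIdeal.2 (hJ a b c)

/-- A two-sided ideal containing all fourfold commutators contains `M_4`. -/
theorem idealM_four_le {J : TwoSidedIdeal A} (hJ : ∀ a b c d : A, ⁅a, ⁅b, ⁅c, d⁆⁆⁆ ∈ J) :
    idealM A 4 ≤ J := by
  refine TwoSidedIdeal.span_le.2 ?_
  suffices h : (lowerCentral A 4).toSubmodule ≤ J.asIdeal.restrictScalars ℂ by
    intro x hx
    exact TwoSidedIdeal.mem_asIdeal.1 (h hx)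
  change (LieModule.lowerCentralSeries ℂ A A (2 + 1)).toSubmodule ≤ _
  rw [LieModule.lowerCentralSeries_succ, LieSubmodule.lieIdeal_oper_eq_linear_span',
    Submodule.span_le]
  rintro _ ⟨a, _, y, hy, rfl⟩
  suffices h : (LieModule.lowerCentralSeries ℂ A A (1 + 1)).toSubmodule
      ≤ (J.asIdeal.restrictScalars ℂ).comap (LieModule.toEnd ℂ A A a) from h hy
  rw [LieModule.lowerCentralSeries_succ, LieSubmodule.lieIdeal_oper_eq_linear_span',
    Submodule.span_le]
  rintro _ ⟨b, _, z, hz, rfl⟩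
  suffices h : (LieModule.lowerCentralSeries ℂ A A (0 + 1)).toSubmodule
      ≤ (J.asIdeal.restrictScalars ℂ).comap
        (LieModule.toEnd ℂ A A a ∘ₗ LieModule.toEnd ℂ A A b) from h hz
  rw [LieModule.lowerCentralSeries_succ, LieSubmodule.lieIdeal_oper_eq_linear_span',
    Submodule.span_le]
  rintro _ ⟨c, _, d, _, rfl⟩
  exact TwoSidedIdeal.mem_asIdeal.2 (hJ a b c d)

end Quotients


/-! ### The images of the free Lie algebra and of its derived algebra in Q_4 -/

section FreeLie

attribute [local instance] LieRing.ofAssociativeRing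

variable (n : ℕ)

/-- The vector representation inside the free algebra. -/
def vec : (Fin n → ℂ) →ₗ[ℂ] An n := Fintype.linearCombination ℂ (FreeAlgebra.ι ℂ)

theorem vec_single (i : Fin n) : vec n (Pi.single i 1) = FreeAlgebra.ι ℂ i := by
  simp [vec, Fintype.linearCombination_apply_single]

theorem ι_mem_freeLie (i : Fin n) : FreeAlgebra.ι ℂ i ∈ freeLie n :=
  ⟨FreeLieAlgebra.of ℂ i, FreeLieAlgebra.lift_of_apply _ _⟩

theorem vec_mem_freeLie (v : Fin n → ℂ) : vec n v ∈ freeLie n := by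
  rw [vec, Fintype.linearCombination_apply]
  exact Submodule.sum_mem (freeLie n).toSubmodule fun i _ =>
    Submodule.smul_mem _ _ (ι_mem_freeLie n i)

theorem glAlg_vec (g : GL (Fin n) ℂ) (v : Fin n → ℂ) :
    glAlg g (vec n v) = vec n (vecRep n g v) := by
  suffices h : (glAlg g).toLinearMap ∘ₗ vec n = vec n ∘ₗ vecRep n g from LinearMap.congr_fun h v
  refine (Pi.basisFun ℂ (Fin n)).ext fun j => ?_
  simp only [LinearMap.comp_apply, Pi.basisFun_apply, vec_single, AlgHom.toLinearMap_apply,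
    glAlg_ι]
  simp [vec, Fintype.linearCombination_apply, vecRep]

theorem freeLie_le {S : LieSubalgebra ℂ (An n)} (hS : ∀ i, FreeAlgebra.ι ℂ i ∈ S) :
    freeLie n ≤ S := by
  rintro _ ⟨x, rfl⟩
  let u : FreeLieAlgebra ℂ (Fin n) →ₗ⁅ℂ⁆ S := FreeLieAlgebra.lift ℂ fun i => ⟨_, hS i⟩
  have h : S.incl.comp u = FreeLieAlgebra.lift ℂ (FreeAlgebra.ι ℂ : Fin n → An n) := by
    ext i
    simp [u]
  rw [← h]
  exact (u x).2

/-- The span of the commutators of vectors. -/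
def lieTwo : Submodule ℂ (An n) := Submodule.span ℂ {c | ∃ u v, ⁅vec n u, vec n v⁆ = c}

/-- The span of the triple commutators of vectors. -/
def lieThree : Submodule ℂ (An n) :=
  Submodule.span ℂ {c | ∃ u v w, ⁅⁅vec n u, vec n v⁆, vec n w⁆ = c}

/-- Modulo `M_4`, the commutator of two elements of degree at most three is a combination of
double and triple commutators of vectors. -/
theorem lie_mem_of_mem {p q : Q (An n) 4}
    (hp : p ∈ (LinearMap.range (vec n) ⊔ lieTwo n ⊔ lieThree n).map (Q.mk (An n) 4).toLinearMap)
    (hq : q ∈ (LinearMap.range (vec n) ⊔ lieTwo n ⊔ lieThree n).map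
      (Q.mk (An n) 4).toLinearMap) :
    ⁅p, q⁆ ∈ (lieTwo n ⊔ lieThree n).map (Q.mk (An n) 4).toLinearMap := by
  have h := Q_four_lie_lie_lie (A := An n)
  set T := (lieTwo n ⊔ lieThree n).map (Q.mk (An n) 4).toLinearMap with hT
  have h2 : ∀ u v, ⁅Q.mk (An n) 4 (vec n u), Q.mk (An n) 4 (vec n v)⁆ ∈ T := fun u v =>
    ⟨⁅vec n u, vec n v⁆, Submodule.mem_sup_left (Submodule.subset_span ⟨u, v, rfl⟩),
      Q.mk_lie _ _ _⟩
  have h3 : ∀ u v w, ⁅⁅Q.mk (An n) 4 (vec n u), Q.mk (An n) 4 (vec n v)⁆,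
      Q.mk (An n) 4 (vec n w)⁆ ∈ T := fun u v w =>
    ⟨⁅⁅vec n u, vec n v⁆, vec n w⁆, Submodule.mem_sup_right (Submodule.subset_span ⟨u, v, w, rfl⟩),
      by rw [AlgHom.toLinearMap_apply, Q.mk_lie, Q.mk_lie]⟩
  have hz : ∀ a b c d : Q (An n) 4, ⁅⁅⁅a, b⁆, c⁆, d⁆ = 0 := fun a b c d => by
    rw [LieRing.of_associative_ring_bracket, lie_lie_comm h, sub_self]
  have hz' : ∀ a b c d : Q (An n) 4, ⁅d, ⁅⁅a, b⁆, c⁆⁆ = 0 := fun a b c d => by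
    rw [← lie_skew, hz, neg_zero]
  obtain ⟨a, ha, rfl⟩ := hp
  obtain ⟨b, hb, rfl⟩ := hq
  obtain ⟨a12, ha12, a3, ha3, rfl⟩ := Submodule.mem_sup.1 ha
  obtain ⟨_, ⟨u, rfl⟩, a2, ha2, rfl⟩ := Submodule.mem_sup.1 ha12
  obtain ⟨b12, hb12, b3, hb3, rfl⟩ := Submodule.mem_sup.1 hb
  obtain ⟨_, ⟨v, rfl⟩, b2, hb2, rfl⟩ := Submodule.mem_sup.1 hb12
  clear ha ha12 hb hb12
  simp only [AlgHom.toLinearMap_apply, map_add, lie_add, add_lie]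
  have e3 : ∀ x : Q (An n) 4, ⁅x, Q.mk (An n) 4 b3⁆ = 0 := by
    intro x
    rw [lieThree] at hb3
    induction hb3 using Submodule.span_induction with
    | mem c hc => obtain ⟨u, v, w, rfl⟩ := hc; rw [Q.mk_lie, Q.mk_lie, hz']
    | zero => simp
    | add c d _ _ hc hd => rw [map_add, lie_add, hc, hd, add_zero]
    | smul r c _ hc => rw [map_smul, lie_smul, hc, smul_zero]
  have e3' : ∀ x : Q (An n) 4, ⁅Q.mk (An n) 4 a3, x⁆ = 0 := by
    intro x
    rw [lieThree] at ha3
    induction ha3 using Submodule.span_induction with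
    | mem c hc => obtain ⟨u, v, w, rfl⟩ := hc; rw [Q.mk_lie, Q.mk_lie, hz]
    | zero => simp
    | add c d _ _ hc hd => rw [map_add, add_lie, hc, hd, add_zero]
    | smul r c _ hc => rw [map_smul, smul_lie, hc, smul_zero]
  have e22 : ⁅Q.mk (An n) 4 a2, Q.mk (An n) 4 b2⁆ = 0 := by
    rw [lieTwo] at ha2 hb2
    induction ha2 using Submodule.span_induction with
    | mem c hc =>
      obtain ⟨u, v, rfl⟩ := hc
      induction hb2 using Submodule.span_induction with
      | mem c hc =>
        obtain ⟨u', v', rfl⟩ := hc; rw [Q.mk_lie, Q.mk_lie, lie_lie_lie_eq_zero h]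
      | zero => simp
      | add c d _ _ hc hd => rw [map_add, lie_add, hc, hd, add_zero]
      | smul r c _ hc => rw [map_smul, lie_smul, hc, smul_zero]
    | zero => simp
    | add c d _ _ hc hd => rw [map_add, add_lie, hc, hd, add_zero]
    | smul r c _ hc => rw [map_smul, smul_lie, hc, smul_zero]
  rw [e3, e3, e3, e3', e3', e22]
  simp only [add_zero]
  clear e3 e3' e22
  have e21 : ⁅Q.mk (An n) 4 a2, Q.mk (An n) 4 (vec n v)⁆ ∈ T := by
    rw [lieTwo] at ha2
    induction ha2 using Submodule.span_induction with
    | mem c hc => obtain ⟨u, v, rfl⟩ := hc; rw [Q.mk_lie]; exact h3 _ _ _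
    | zero => simp
    | add c d _ _ hc hd => rw [map_add, add_lie]; exact add_mem hc hd
    | smul r c _ hc => rw [map_smul, smul_lie]; exact Submodule.smul_mem _ _ hc
  refine add_mem (by simpa using add_mem (h2 u v) e21) ?_
  clear e21
  have e12 : ⁅Q.mk (An n) 4 (vec n u), Q.mk (An n) 4 b2⁆ ∈ T := by
    rw [lieTwo] at hb2
    induction hb2 using Submodule.span_induction with
    | mem c hc =>
      obtain ⟨u, v, rfl⟩ := hc
      rw [Q.mk_lie, ← lie_skew]
      exact neg_mem (h3 _ _ _)
    | zero => simp
    | add c d _ _ hc hd => rw [map_add, lie_add]; exact add_mem hc hd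
    | smul r c _ hc => rw [map_smul, lie_smul]; exact Submodule.smul_mem _ _ hc
  exact e12

/-- The image of the free Lie algebra in `Q_4`. -/
theorem mk_mem_of_mem_freeLie {a : An n} (ha : a ∈ freeLie n) :
    Q.mk (An n) 4 a ∈
      (LinearMap.range (vec n) ⊔ lieTwo n ⊔ lieThree n).map (Q.mk (An n) 4).toLinearMap := by
  -- The preimage of the span is a Lie subalgebra, because brackets of its elements already land in
  -- the part without vectors; it contains the generators.
  let S : LieSubalgebra ℂ (An n) :=
    { ((LinearMap.range (vec n) ⊔ lieTwo n ⊔ lieThree n).map (Q.mk (An n) 4).toLinearMap).comap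
        (Q.mk (An n) 4).toLinearMap with
      lie_mem' := by
        intro x y hx hy
        have h := lie_mem_of_mem n hx hy
        rw [AlgHom.toLinearMap_apply, AlgHom.toLinearMap_apply, ← Q.mk_lie] at h
        exact Submodule.map_mono (sup_le_sup_right le_sup_right _) h }
  refine freeLie_le n (S := S) (fun i => ?_) ha
  exact ⟨_, Submodule.mem_sup_left (Submodule.mem_sup_left ⟨_, vec_single n i⟩), rfl⟩

/-- The image of the derived free Lie algebra in `Q_4`. -/
theorem mk_mem_of_mem_derivedLie {a : An n} (ha : a ∈ derivedLie n) :
    Q.mk (An n) 4 a ∈ (lieTwo n ⊔ lieThree n).map (Q.mk (An n) 4).toLinearMap := by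
  rw [derivedLie] at ha
  induction ha using Submodule.span_induction with
  | mem c hc =>
    obtain ⟨a, ha, b, hb, rfl⟩ := hc
    rw [Q.mk_lie]
    exact lie_mem_of_mem n (mk_mem_of_mem_freeLie n ha) (mk_mem_of_mem_freeLie n hb)
  | zero => simp
  | add c d _ _ hc hd => rw [map_add]; exact add_mem hc hd
  | smul r c _ hc => rw [map_smul]; exact Submodule.smul_mem _ _ hc

end FreeLie

/-! ### Models of the free algebra detecting nonzero symbols -/

section Models

attribute [local instance] LieRing.ofAssociativeRing

variable {n : ℕ} {R : Type*} [Ring R] [Algebra ℂ R] (r : Fin n → R)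

/-- The homomorphism `x_i ↦ r_i s` from the free algebra to the polynomials in `s` over `R`. -/
def scale : An n →ₐ[ℂ] R[X] := FreeAlgebra.lift ℂ fun i => Polynomial.X * Polynomial.C (r i)

theorem scale_vec (v : Fin n → ℂ) :
    scale r (vec n v) = Polynomial.X * Polynomial.C (Fintype.linearCombination ℂ r v) := by
  simp only [vec, Fintype.linearCombination_apply, map_sum, map_smul, scale,
    FreeAlgebra.lift_ι_apply, Finset.mul_sum]
  refine Finset.sum_congr rfl fun i _ => ?_
  rw [← Polynomial.smul_C, mul_smul_comm]

/-- The scalar constant term is central, so bracketing with an image raises the order in `X` by at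
least one. The control on the linear term matters only when the commutators of the `r i` are
central. -/
theorem scale_eq (a : An n) : ∃ (c : ℂ) (p : R[X]),
    scale r a = algebraMap ℂ R[X] c + Polynomial.X * p ∧
      p.coeff 0 ∈ Submodule.span ℂ (Set.range r) := by
  induction a using FreeAlgebra.induction with
  | grade0 c => exact ⟨c, 0, by simp, by simp⟩
  | grade1 i =>
    exact ⟨0, Polynomial.C (r i), by simp [scale], by
      rw [Polynomial.coeff_C_zero]; exact Submodule.subset_span ⟨i, rfl⟩⟩
  | mul a b ha hb =>
    obtain ⟨c, p, h, hp⟩ := ha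
    obtain ⟨d, q, h', hq⟩ := hb
    refine ⟨c * d, c • q + d • p + Polynomial.X * (p * q), ?_, ?_⟩
    · rw [map_mul, h, h', map_mul]
      simp only [mul_add, add_mul, Algebra.algebraMap_eq_smul_one, smul_mul_assoc, one_mul,
        mul_one, mul_smul_comm, mul_assoc, Polynomial.X_mul, smul_add, smul_smul, mul_comm d c]
      abel
    · simp only [Polynomial.coeff_add, Polynomial.coeff_smul, Polynomial.mul_coeff_zero,
        Polynomial.coeff_X_zero, zero_mul, add_zero]
      exact add_mem (Submodule.smul_mem _ _ hq) (Submodule.smul_mem _ _ hp)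
  | add a b ha hb =>
    obtain ⟨c, p, h, hp⟩ := ha
    obtain ⟨d, q, h', hq⟩ := hb
    refine ⟨c + d, p + q, ?_, ?_⟩
    · rw [map_add, h, h', map_add, mul_add]; abel
    · rw [Polynomial.coeff_add]; exact add_mem hp hq

theorem lie_X_pow_mul (c : ℂ) (p q : R[X]) (k : ℕ) :
    ⁅algebraMap ℂ R[X] c + Polynomial.X * p, Polynomial.X ^ k * q⁆
      = Polynomial.X ^ (k + 1) * ⁅p, q⁆ := by
  have h1 : algebraMap ℂ R[X] c * (Polynomial.X ^ k * q)
      = Polynomial.X ^ k * q * algebraMap ℂ R[X] c := Algebra.commutes _ _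
  have h2 : Polynomial.X * p * (Polynomial.X ^ k * q) = Polynomial.X ^ (k + 1) * (p * q) := by
    rw [← mul_assoc, mul_assoc _ p, ← Polynomial.X_pow_mul, pow_succ']; simp only [mul_assoc]
  have h3 : Polynomial.X ^ k * q * (Polynomial.X * p) = Polynomial.X ^ (k + 1) * (q * p) := by
    rw [← mul_assoc, mul_assoc _ q, ← Polynomial.X_mul, pow_succ]; simp only [mul_assoc]
  rw [LieRing.of_associative_ring_bracket, LieRing.of_associative_ring_bracket, add_mul, mul_add,
    h1, h2, h3, mul_sub]
  abel

theorem lie_scale_scale (a b : An n) : ∃ p q : R[X],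
    ⁅scale r a, scale r b⁆ = Polynomial.X ^ 2 * ⁅p, q⁆ ∧
      p.coeff 0 ∈ Submodule.span ℂ (Set.range r) ∧
      q.coeff 0 ∈ Submodule.span ℂ (Set.range r) := by
  obtain ⟨c, p, h, hp⟩ := scale_eq r a
  obtain ⟨d, q, h', hq⟩ := scale_eq r b
  refine ⟨p, q, ?_, hp, hq⟩
  have h1 := lie_X_pow_mul c p q 1
  rw [pow_one] at h1
  rw [h, h', lie_add, h1]
  rw [LieRing.of_associative_ring_bracket, Algebra.commutes, sub_self, zero_add]

/-- The two-sided ideal of polynomials of order at least `k`. -/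
def orderIdeal (R : Type*) [Ring R] (k : ℕ) : TwoSidedIdeal R[X] :=
  TwoSidedIdeal.mk' {p | Polynomial.X ^ k ∣ p} (dvd_zero _) (fun h h' => dvd_add h h')
    (fun h => (dvd_neg).2 h)
    (fun {x y} h => by
      obtain ⟨z, rfl⟩ := h
      exact ⟨x * z, by rw [← mul_assoc, ← Polynomial.X_pow_mul, mul_assoc]⟩)
    (fun h => Dvd.dvd.mul_right h _)

theorem mem_orderIdeal {R : Type*} [Ring R] {k : ℕ} {p : R[X]} : p ∈ orderIdeal R k ↔ Polynomial.X ^ k ∣ p :=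
  TwoSidedIdeal.mem_mk' ..

theorem coeff_eq_zero_of_mem_orderIdeal {R : Type*} [Ring R] {k j : ℕ} (hj : j < k) {p : R[X]}
    (h : p ∈ orderIdeal R k) : p.coeff j = 0 :=
  Polynomial.X_pow_dvd_iff.1 (mem_orderIdeal.1 h) j hj

theorem scale_mem_orderIdeal_four {a : An n} (ha : a ∈ idealM (An n) 4) :
    scale r a ∈ orderIdeal R 4 := by
  suffices h : idealM (An n) 4 ≤ (orderIdeal R 4).comap (scale r) from
    (TwoSidedIdeal.mem_comap _).1 (h ha)
  refine idealM_four_le fun a b c d => (TwoSidedIdeal.mem_comap _).2 (mem_orderIdeal.2 ?_)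
  obtain ⟨p, q, h, -, -⟩ := lie_scale_scale r c d
  obtain ⟨ca, pa, ha, -⟩ := scale_eq r a
  obtain ⟨cb, pb, hb, -⟩ := scale_eq r b
  have e : scale r ⁅a, ⁅b, ⁅c, d⁆⁆⁆ = ⁅scale r a, ⁅scale r b, ⁅scale r c, scale r d⁆⁆⁆ := by
    simp only [LieRing.of_associative_ring_bracket, map_sub, map_mul]
  rw [e, h, ha, hb, lie_X_pow_mul, lie_X_pow_mul]
  exact Dvd.intro _ rfl

/-- An innermost bracket is `X ^ 2` times a polynomial whose constant coefficient is central. The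
next bracket kills that coefficient and so gains one power more than the generic estimate of order
four. The extra power leaves the coefficient of `X ^ 4` free to detect products of two commutators.
-/
theorem scale_mem_orderIdeal_five (hr : ∀ i j, ∀ x : R, ⁅x, ⁅r i, r j⁆⁆ = 0) {a : An n}
    (ha : a ∈ idealM (An n) 4) : scale r a ∈ orderIdeal R 5 := by
  have hr' : ∀ u ∈ Submodule.span ℂ (Set.range r), ∀ v ∈ Submodule.span ℂ (Set.range r),
      ∀ x : R, ⁅x, ⁅u, v⁆⁆ = 0 := by
    intro u hu v hv x
    induction hu using Submodule.span_induction with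
    | mem c hc =>
      obtain ⟨i, rfl⟩ := hc
      induction hv using Submodule.span_induction with
      | mem c hc => obtain ⟨j, rfl⟩ := hc; exact hr i j x
      | zero => simp
      | add c d _ _ hc hd => rw [lie_add, lie_add, hc, hd, add_zero]
      | smul r c _ hc => rw [lie_smul, lie_smul, hc, smul_zero]
    | zero => simp
    | add c d _ _ hc hd => rw [add_lie, lie_add, hc, hd, add_zero]
    | smul r c _ hc => rw [smul_lie, lie_smul, hc, smul_zero]
  suffices h : idealM (An n) 4 ≤ (orderIdeal R 5).comap (scale r) from
    (TwoSidedIdeal.mem_comap _).1 (h ha)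
  refine idealM_four_le fun a b c d => (TwoSidedIdeal.mem_comap _).2 (mem_orderIdeal.2 ?_)
  obtain ⟨p, q, h, hp, hq⟩ := lie_scale_scale r c d
  obtain ⟨ca, pa, ha, -⟩ := scale_eq r a
  obtain ⟨cb, pb, hb, -⟩ := scale_eq r b
  have e : scale r ⁅a, ⁅b, ⁅c, d⁆⁆⁆ = ⁅scale r a, ⁅scale r b, ⁅scale r c, scale r d⁆⁆⁆ := by
    simp only [LieRing.of_associative_ring_bracket, map_sub, map_mul]
  have hpq : ⁅p, q⁆ = Polynomial.C ⁅p.coeff 0, q.coeff 0⁆ + Polynomial.X * ⁅p, q⁆.divX := by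
    conv_lhs => rw [← Polynomial.divX_mul_X_add ⁅p, q⁆, ← Polynomial.X_mul, add_comm]
    congr 2
    simp [LieRing.of_associative_ring_bracket, Polynomial.mul_coeff_zero]
  have hC : ∀ z : R, (∀ x : R, ⁅x, z⁆ = 0) → ∀ f : R[X], ⁅f, Polynomial.C z⁆ = 0 := by
    intro z hz f
    ext k
    simpa [LieRing.of_associative_ring_bracket] using hz (f.coeff k)
  have hb' : ⁅pb, ⁅p, q⁆⁆ = Polynomial.X * ⁅pb, ⁅p, q⁆.divX⁆ := by
    conv_lhs => rw [hpq, lie_add, hC _ (hr' _ hp _ hq), zero_add]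
    simp only [LieRing.of_associative_ring_bracket, mul_sub, mul_assoc]
    congr 1
    rw [← mul_assoc, ← Polynomial.X_mul, mul_assoc]
  rw [e, h, ha, hb, lie_X_pow_mul, hb', ← mul_assoc, ← pow_succ, lie_X_pow_mul]
  exact Dvd.intro _ rfl

theorem scale_lie_vec (u v : Fin n → ℂ) :
    scale r ⁅vec n u, vec n v⁆ = Polynomial.X ^ 2 *
      Polynomial.C ⁅Fintype.linearCombination ℂ r u, Fintype.linearCombination ℂ r v⁆ := by
  simp only [LieRing.of_associative_ring_bracket, map_sub, map_mul, scale_vec]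
  simp only [Polynomial.X_mul, pow_succ, mul_sub, pow_zero, one_mul, mul_assoc]

theorem scale_lie_lie_vec (u v w : Fin n → ℂ) :
    scale r ⁅⁅vec n u, vec n v⁆, vec n w⁆ = Polynomial.X ^ 3 *
      Polynomial.C ⁅⁅Fintype.linearCombination ℂ r u, Fintype.linearCombination ℂ r v⁆,
        Fintype.linearCombination ℂ r w⁆ := by
  have h := lie_X_pow_mul 0 (Polynomial.C (Fintype.linearCombination ℂ r w))
    (Polynomial.C ⁅Fintype.linearCombination ℂ r u, Fintype.linearCombination ℂ r v⁆) 2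
  rw [map_zero, zero_add, ← scale_lie_vec, ← scale_vec, ← neg_inj, lie_skew, ← mul_neg,
    lie_skew] at h
  simpa only [LieRing.of_associative_ring_bracket, map_sub, map_mul] using h

theorem coeff_scale_of_mem_lieTwo {m : An n} (hm : m ∈ lieTwo n) {k : ℕ} (hk : k ≠ 2) :
    (scale r m).coeff k = 0 := by
  rw [lieTwo] at hm
  induction hm using Submodule.span_induction with
  | mem c hc =>
    obtain ⟨u, v, rfl⟩ := hc
    rw [scale_lie_vec, Polynomial.X_pow_mul, Polynomial.coeff_C_mul_X_pow, if_neg hk]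
  | zero => simp
  | add c d _ _ hc hd => rw [map_add, Polynomial.coeff_add, hc, hd, add_zero]
  | smul r c _ hc => rw [map_smul, Polynomial.coeff_smul, hc, smul_zero]

theorem coeff_scale_of_mem_lieThree {m : An n} (hm : m ∈ lieThree n) {k : ℕ} (hk : k ≠ 3) :
    (scale r m).coeff k = 0 := by
  rw [lieThree] at hm
  induction hm using Submodule.span_induction with
  | mem c hc =>
    obtain ⟨u, v, w, rfl⟩ := hc
    rw [scale_lie_lie_vec, Polynomial.X_pow_mul, Polynomial.coeff_C_mul_X_pow, if_neg hk]
  | zero => simp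
  | add c d _ _ hc hd => rw [map_add, Polynomial.coeff_add, hc, hd, add_zero]
  | smul r c _ hc => rw [map_smul, Polynomial.coeff_smul, hc, smul_zero]

/-- A triple commutator of vectors is not constant modulo `M_4`. -/
theorem mk_lie_lie_vec_notMem (hn : 2 ≤ n) :
    ∃ u v : Fin n → ℂ, Q.mk (An n) 4 ⁅⁅vec n u, vec n v⁆, vec n u⁆ ∉ qFil n 4 0 := by
  let i : Fin n := ⟨0, by omega⟩
  let j : Fin n := ⟨1, by omega⟩
  have hij : i ≠ j := by simp [i, j, Fin.ext_iff]
  refine ⟨Pi.single i 1, Pi.single j 1, ?_⟩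
  rintro ⟨a, ha, hab⟩
  rw [lieFil, pow_zero] at ha
  obtain ⟨c, rfl⟩ := Submodule.mem_one.1 ha
  rw [AlgHom.toLinearMap_apply, eq_comm, ← sub_eq_zero, ← map_sub, Q.mk_eq_zero] at hab
  -- With E = e_00 and F = e_01 one has [E,F] = F and [[E,F],E] = -F, so the coefficient of `X ^ 3`
  -- is nonzero, while constants have none and M_4 starts in order four.
  let r : Fin n → Matrix (Fin 2) (Fin 2) ℂ := fun k =>
    if k = i then Matrix.single 0 0 1 else Matrix.single 0 1 1
  have h := coeff_eq_zero_of_mem_orderIdeal (show 3 < 4 by norm_num)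
    (scale_mem_orderIdeal_four r hab)
  have h1 : scale r (⁅⁅vec n (Pi.single i 1), vec n (Pi.single j 1)⁆, vec n (Pi.single i 1)⁆
      - algebraMap ℂ (An n) c)
      = Polynomial.X ^ 3 * Polynomial.C ⁅⁅r i, r j⁆, r i⁆ - algebraMap ℂ _ c := by
    rw [map_sub, scale_lie_lie_vec, AlgHom.commutes]
    simp only [Fintype.linearCombination_apply_single, one_smul]
  rw [h1, Polynomial.coeff_sub, Polynomial.coeff_X_pow_mul', Polynomial.algebraMap_apply,
    Polynomial.coeff_C_of_ne_zero (show 3 ≠ 0 by norm_num), if_pos le_rfl, Nat.sub_self,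
    Polynomial.coeff_C_zero, sub_zero] at h
  have h2 := congrFun (congrFun h 0) 1
  simp [LieRing.of_associative_ring_bracket, r, hij.symm, Matrix.single, Matrix.mul_apply,
    Fin.sum_univ_two] at h2

/-- The square of a commutator of vectors is not congruent modulo `M_4` to an element of Lie
degree at most one. -/
theorem mk_lie_sq_notMem (hn : 2 ≤ n) :
    ∃ u v : Fin n → ℂ, Q.mk (An n) 4 (⁅vec n u, vec n v⁆ * ⁅vec n u, vec n v⁆) ∉ qFil n 4 1 := by
  let i : Fin n := ⟨0, by omega⟩
  let j : Fin n := ⟨1, by omega⟩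
  have hij : i ≠ j := by simp [i, j, Fin.ext_iff]
  refine ⟨Pi.single i 1, Pi.single j 1, ?_⟩
  rintro ⟨a, ha, hab⟩
  rw [lieFil, pow_one] at ha
  obtain ⟨a0, ha0, l, hl, rfl⟩ := Submodule.mem_sup.1 ha
  obtain ⟨c, rfl⟩ := Submodule.mem_one.1 ha0
  obtain ⟨m, hm, hml⟩ := mk_mem_of_mem_freeLie n hl
  rw [map_add, AlgHom.toLinearMap_apply, AlgHom.toLinearMap_apply, ← hml,
    AlgHom.toLinearMap_apply, eq_comm, ← map_add, ← sub_eq_zero, ← map_sub, Q.mk_eq_zero] at hab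
  -- The Weyl algebra: d/dX and multiplication by X have commutator 1, so the squared commutator
  -- maps to `X ^ 4`. Elements of Lie degree at most one reduce modulo M_4 to terms of order at most
  -- three, and M_4 itself maps to order at least five.
  let r : Fin n → Module.End ℂ ℂ[X] := fun k =>
    if k = i then Polynomial.derivative else if k = j then LinearMap.mulLeft ℂ Polynomial.X else 0
  have hrij : ⁅r i, r j⁆ = 1 := by
    refine LinearMap.ext fun p => ?_
    simp [r, hij.symm, LieRing.of_associative_ring_bracket]
  have hr : ∀ k l, ∀ x : Module.End ℂ ℂ[X], ⁅x, ⁅r k, r l⁆⁆ = 0 := by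
    have h1 : ∀ x : Module.End ℂ ℂ[X], ⁅x, (1 : Module.End ℂ ℂ[X])⁆ = 0 := fun x => by
      rw [LieRing.of_associative_ring_bracket, mul_one, one_mul, sub_self]
    have h0 : ∀ k, k ≠ i → k ≠ j → r k = 0 := fun k hi hj => by simp [r, hi, hj]
    intro k l x
    by_cases hki : k = i
    · by_cases hli : l = i
      · rw [hki, hli, lie_self, lie_zero]
      · by_cases hlj : l = j
        · rw [hki, hlj, hrij, h1]
        · rw [h0 l hli hlj, lie_zero, lie_zero]
    · by_cases hkj : k = j
      · by_cases hli : l = i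
        · rw [hkj, hli, ← lie_skew (r j) (r i), hrij, lie_neg, h1, neg_zero]
        · by_cases hlj : l = j
          · rw [hkj, hlj, lie_self, lie_zero]
          · rw [h0 l hli hlj, lie_zero, lie_zero]
      · rw [h0 k hki hkj, zero_lie, lie_zero]
  have h := coeff_eq_zero_of_mem_orderIdeal (show 4 < 5 by norm_num)
    (scale_mem_orderIdeal_five r hr hab)
  have hmc : (scale r m).coeff 4 = 0 := by
    obtain ⟨m12, hm12, m3, hm3, rfl⟩ := Submodule.mem_sup.1 hm
    obtain ⟨_, ⟨u, rfl⟩, m2, hm2, rfl⟩ := Submodule.mem_sup.1 hm12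
    rw [map_add, map_add, Polynomial.coeff_add, Polynomial.coeff_add, scale_vec]
    rw [coeff_scale_of_mem_lieTwo r hm2 (by norm_num),
      coeff_scale_of_mem_lieThree r hm3 (by norm_num)]
    simp
  have h1 : scale r ⁅vec n (Pi.single i 1), vec n (Pi.single j 1)⁆ = Polynomial.X ^ 2 := by
    rw [scale_lie_vec]
    simp only [Fintype.linearCombination_apply_single, one_smul]
    rw [hrij, map_one, mul_one]
  rw [map_sub, map_add, map_mul, h1, Polynomial.coeff_sub, Polynomial.coeff_add, hmc,
    AlgHom.commutes, Polynomial.algebraMap_apply, Polynomial.coeff_C_of_ne_zero (by norm_num),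
    ← pow_add, Polynomial.coeff_X_pow_self] at h
  simp at h

end Models


/-! ### The exterior algebra as a target for Q_3 and its associated graded algebra -/

section Exterior

attribute [local instance] LieRing.ofAssociativeRing

variable {M : Type*} [AddCommGroup M] [Module ℂ M]

/-- For the zero form all vectors are orthogonal, so an even element commutes with every homogeneous
one, and these span. -/
theorem exterior_mul_comm {x y : ExteriorAlgebra ℂ M}
    (hx : x ∈ CliffordAlgebra.evenOdd (0 : QuadraticForm ℂ M) 0) : x * y = y * x := by
  have key : ∀ i : ZMod 2, ∀ y ∈ CliffordAlgebra.evenOdd (0 : QuadraticForm ℂ M) i,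
      x * y = y * x := by
    intro i y hy
    have h := CliffordAlgebra.map_mul_map_of_isOrtho_of_mem_evenOdd
      (QuadraticMap.Isometry.id (0 : QuadraticForm ℂ M)) (QuadraticMap.Isometry.id _)
      (fun a b => by simp [QuadraticMap.isOrtho_def]) x y hx hy
    simpa using h
  obtain ⟨y0, hy0, y1, hy1, rfl⟩ := Submodule.mem_sup.1
    ((CliffordAlgebra.evenOdd_isCompl (Q := (0 : QuadraticForm ℂ M))).sup_eq_top ▸
      Submodule.mem_top : y ∈ _)
  rw [mul_add, add_mul, key 0 y0 hy0, key 1 y1 hy1]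

/-- The exterior algebra is Lie nilpotent of class 2. -/
theorem exterior_lie_lie (a b c : ExteriorAlgebra ℂ M) : ⁅a, ⁅b, c⁆⁆ = 0 := by
  have h : ⁅b, c⁆ ∈ CliffordAlgebra.evenOdd (0 : QuadraticForm ℂ M) 0 := by
    have htop := (CliffordAlgebra.evenOdd_isCompl (Q := (0 : QuadraticForm ℂ M))).sup_eq_top
    obtain ⟨b0, hb0, b1, hb1, rfl⟩ := Submodule.mem_sup.1 (htop ▸ Submodule.mem_top : b ∈ _)
    obtain ⟨c0, hc0, c1, hc1, rfl⟩ := Submodule.mem_sup.1 (htop ▸ Submodule.mem_top : c ∈ _)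
    have h1 : ∀ y : ExteriorAlgebra ℂ M, ⁅b0, y⁆ = 0 := fun y => by
      rw [LieRing.of_associative_ring_bracket, exterior_mul_comm hb0, sub_self]
    have h2 : ∀ y : ExteriorAlgebra ℂ M, ⁅y, c0⁆ = 0 := fun y => by
      rw [LieRing.of_associative_ring_bracket, exterior_mul_comm hc0, sub_self]
    rw [add_lie, h1, zero_add, lie_add, h2, zero_add, LieRing.of_associative_ring_bracket]
    have hmul : ∀ x ∈ CliffordAlgebra.evenOdd (0 : QuadraticForm ℂ M) 1,
        ∀ y ∈ CliffordAlgebra.evenOdd (0 : QuadraticForm ℂ M) 1,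
        x * y ∈ CliffordAlgebra.evenOdd (0 : QuadraticForm ℂ M) 0 := fun x hx y hy => by
      have h := SetLike.mul_mem_graded (A := CliffordAlgebra.evenOdd (0 : QuadraticForm ℂ M)) hx hy
      rwa [show (1 + 1 : ZMod 2) = 0 from rfl] at h
    exact sub_mem (hmul _ hb1 _ hc1) (hmul _ hc1 _ hb1)
  rw [LieRing.of_associative_ring_bracket, exterior_mul_comm h, sub_self]

theorem polynomial_lie_lie {R : Type*} [Ring R] (hR : ∀ a b c : R, ⁅a, ⁅b, c⁆⁆ = 0)
    (p q f : R[X]) : ⁅p, ⁅q, f⁆⁆ = 0 := by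
  have hmono : ∀ (i j : ℕ) (a b : R), ⁅Polynomial.monomial i a, Polynomial.monomial j b⁆
      = Polynomial.monomial (i + j) ⁅a, b⁆ := by
    intro i j a b
    rw [LieRing.of_associative_ring_bracket, Polynomial.monomial_mul_monomial,
      Polynomial.monomial_mul_monomial, add_comm j i, ← map_sub,
      LieRing.of_associative_ring_bracket]
  induction p using Polynomial.induction_on' with
  | add p p' h h' => rw [add_lie, h, h', add_zero]
  | monomial i a =>
    induction q using Polynomial.induction_on' with
    | add p p' h h' => rw [add_lie, lie_add, h, h', add_zero]
    | monomial j b =>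
      induction f using Polynomial.induction_on' with
      | add p p' h h' => rw [lie_add, lie_add, h, h', add_zero]
      | monomial k c => rw [hmono, hmono, hR, map_zero]

variable (n : ℕ)

/-- The even part of the exterior algebra of the vector representation. -/
abbrev EvenExt : Type := CliffordAlgebra.even (0 : QuadraticForm ℂ (Fin n → ℂ))

/-- The generators of the exterior algebra. -/
def extGen (i : Fin n) : ExteriorAlgebra ℂ (Fin n → ℂ) :=
  ExteriorAlgebra.ι ℂ (Pi.single i 1)

theorem linearCombination_extGen (v : Fin n → ℂ) :
    Fintype.linearCombination ℂ (extGen n) v = ExteriorAlgebra.ι ℂ v := by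
  suffices h : Fintype.linearCombination ℂ (extGen n) = ExteriorAlgebra.ι ℂ from
    LinearMap.congr_fun h v
  refine (Pi.basisFun ℂ (Fin n)).ext fun j => ?_
  simp [extGen, Fintype.linearCombination_apply_single]

theorem scale_extGen_eq_zero {a : An n} (ha : a ∈ idealM (An n) 3) : scale (extGen n) a = 0 := by
  suffices h : idealM (An n) 3 ≤ (⊥ : TwoSidedIdeal _).comap (scale (extGen n)) from
    (TwoSidedIdeal.mem_bot _).1 ((TwoSidedIdeal.mem_comap _).1 (h ha))
  refine idealM_three_le fun a b c =>
    (TwoSidedIdeal.mem_comap _).2 ((TwoSidedIdeal.mem_bot _).2 ?_)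
  have h := polynomial_lie_lie exterior_lie_lie (scale (extGen n) a) (scale (extGen n) b)
    (scale (extGen n) c)
  simpa only [LieRing.of_associative_ring_bracket, map_sub, map_mul] using h

/-- The homomorphism from `Q_3` to the polynomials over the exterior algebra. -/
def scaleQ : Q (An n) 3 →ₐ[ℂ] (ExteriorAlgebra ℂ (Fin n → ℂ))[X] :=
  RingCon.liftₐ _ (scale (extGen n)) (Q.lift_aux _ fun _ ha => scale_extGen_eq_zero n ha)

/-- Polynomials of degree at most `k`, as a complex subspace. -/
def degLE (R : Type*) [Ring R] [Algebra ℂ R] (k : ℕ) : Submodule ℂ R[X] where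
  carrier := {p | p.natDegree ≤ k}
  add_mem' h h' := Polynomial.natDegree_add_le_of_degree_le h h'
  zero_mem' := by simp
  smul_mem' c p h := (Polynomial.natDegree_smul_le c p).trans h

/-- Triple commutators lie in M_3 and map to zero, leaving vectors in degree one and their
commutators in degree two. Hence each Lie factor costs at most two in polynomial degree. -/
theorem scale_mem_degLE_of_mem_freeLie {a : An n} (ha : a ∈ freeLie n) :
    scale (extGen n) a ∈ degLE _ 2 := by
  obtain ⟨m, hm, hma⟩ := mk_mem_of_mem_freeLie n ha
  rw [AlgHom.toLinearMap_apply, ← sub_eq_zero, ← map_sub, Q.mk_eq_zero] at hma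
  have h := scale_extGen_eq_zero n (idealM_succ_le 3 hma)
  rw [map_sub, sub_eq_zero] at h
  rw [← h]
  obtain ⟨m12, hm12, m3, hm3, rfl⟩ := Submodule.mem_sup.1 hm
  obtain ⟨_, ⟨u, rfl⟩, m2, hm2, rfl⟩ := Submodule.mem_sup.1 hm12
  have h3 : scale (extGen n) m3 = 0 := by
    refine scale_extGen_eq_zero n ?_
    have hle : lieThree n ≤ (idealM (An n) 3).asIdeal.restrictScalars ℂ := by
      refine Submodule.span_le.2 ?_
      rintro _ ⟨u, v, w, rfl⟩
      refine TwoSidedIdeal.mem_asIdeal.2 ?_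
      rw [← lie_skew]
      exact TwoSidedIdeal.neg_mem _ (TwoSidedIdeal.subset_span (lie_lie_mem_lowerCentral _ _ _))
    exact TwoSidedIdeal.mem_asIdeal.1 (hle hm3)
  rw [map_add, map_add, h3, add_zero]
  refine add_mem ?_ ?_
  · rw [scale_vec]
    refine (Polynomial.natDegree_mul_le).trans ?_
    rw [Polynomial.natDegree_C, add_zero]
    exact Polynomial.natDegree_X_le.trans (by norm_num)
  · refine Polynomial.natDegree_le_iff_coeff_eq_zero.2 fun k hk => ?_
    exact coeff_scale_of_mem_lieTwo _ hm2 hk.ne'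

theorem scale_mem_degLE {d : ℕ} {a : An n} (ha : a ∈ lieFil n d) :
    scale (extGen n) a ∈ degLE _ (2 * d) := by
  suffices h : lieFil n d ≤ (degLE _ (2 * d)).comap (scale (extGen n)).toLinearMap from h ha
  clear ha
  induction d with
  | zero =>
    rw [lieFil, pow_zero]
    intro x hx
    obtain ⟨c, rfl⟩ := Submodule.mem_one.1 hx
    rw [Submodule.mem_comap, AlgHom.toLinearMap_apply, AlgHom.commutes,
      Polynomial.algebraMap_apply]
    exact (Polynomial.natDegree_C _).le
  | succ d ih =>
    rw [lieFil, pow_succ, Submodule.mul_le]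
    intro x hx y hy
    have hy' : (scale (extGen n) y).natDegree ≤ 2 := by
      obtain ⟨c', hc, l, hl, rfl⟩ := Submodule.mem_sup.1 hy
      obtain ⟨c, rfl⟩ := Submodule.mem_one.1 hc
      rw [map_add, AlgHom.commutes, Polynomial.algebraMap_apply]
      exact Polynomial.natDegree_add_le_of_degree_le
        ((Polynomial.natDegree_C _).le.trans (by norm_num)) (scale_mem_degLE_of_mem_freeLie n hl)
    have hx' : (scale (extGen n) x).natDegree ≤ 2 * d := ih hx
    rw [Submodule.mem_comap, AlgHom.toLinearMap_apply, map_mul]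
    exact Polynomial.natDegree_mul_le.trans (by omega)

theorem natDegree_scaleQ_le {d : ℕ} {a : Q (An n) 3} (ha : a ∈ qFil n 3 d) :
    (scaleQ n a).natDegree ≤ 2 * d := by
  obtain ⟨b, hb, rfl⟩ := ha
  exact scale_mem_degLE n hb

/-- The linear map extracting, from the `d`-th coefficient of an element of the Rees algebra of
`Q_3`, its component of exterior degree `2d`. -/
def topCoeff (p : (Q (An n) 3)[X]) : (ExteriorAlgebra ℂ (Fin n → ℂ))[X] :=
  ∑ d ∈ p.support, Polynomial.monomial d ((scaleQ n (p.coeff d)).coeff (2 * d))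

theorem coeff_topCoeff (p : (Q (An n) 3)[X]) (d : ℕ) :
    (topCoeff n p).coeff d = (scaleQ n (p.coeff d)).coeff (2 * d) := by
  rw [topCoeff, Polynomial.finsetSum_coeff]
  simp only [Polynomial.coeff_monomial, Finset.sum_ite_eq']
  split_ifs with h
  · rfl
  · rw [Polynomial.notMem_support_iff.1 h, map_zero, Polynomial.coeff_zero]

/-- The algebra homomorphism from the Rees algebra of `Q_3` given by top components. -/
def reesToExt : rees (qFil n 3) →ₐ[ℂ] (ExteriorAlgebra ℂ (Fin n → ℂ))[X] where
  toFun p := topCoeff n p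
  map_one' := by
    ext1 d
    rw [coeff_topCoeff]
    by_cases hd : d = 0
    · subst hd; simp
    · simp [Polynomial.coeff_one, hd]
  map_mul' p q := by
    ext1 d
    rw [coeff_topCoeff, Polynomial.coeff_mul, MulMemClass.coe_mul, Polynomial.coeff_mul, map_sum,
      Polynomial.finsetSum_coeff]
    refine Finset.sum_congr rfl fun x hx => ?_
    rw [map_mul, coeff_topCoeff, coeff_topCoeff, ← Finset.HasAntidiagonal.mem_antidiagonal.1 hx,
      mul_add]
    -- Since step `d` has degree at most `2 * d`, the coefficient at `2 * d` is the potential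
    -- leading one, and such coefficients multiply.
    exact Polynomial.coeff_mul_add_eq_of_natDegree_le
      (natDegree_scaleQ_le n (p.2 _)) (natDegree_scaleQ_le n (q.2 _))
  map_zero' := by
    ext1 d
    rw [coeff_topCoeff]; simp
  map_add' p q := by
    ext1 d
    rw [coeff_topCoeff, Polynomial.coeff_add, coeff_topCoeff, coeff_topCoeff]; simp
  commutes' c := by
    ext1 d
    rw [coeff_topCoeff]
    by_cases hd : d = 0
    · subst hd; simp [Polynomial.algebraMap_apply]
    · simp [Polynomial.algebraMap_apply, Polynomial.coeff_C, hd]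

/-- The algebra homomorphism from `D_3` given by top components. -/
def grToExt : D n 3 →ₐ[ℂ] (ExteriorAlgebra ℂ (Fin n → ℂ))[X] :=
  RingCon.liftₐ _ (reesToExt n) (by
    intro x y hxy
    have h := (mem_grIdeal (qFil n 3)).1 ((TwoSidedIdeal.rel_iff _ _ _).1 hxy)
    refine (RingCon.ker_apply _).2 (sub_eq_zero.1 ?_)
    rw [← map_sub]
    change reesToExt n (x - y) = 0
    ext1 d
    change (topCoeff n _).coeff d = _
    rw [coeff_topCoeff, Polynomial.coeff_zero]
    have hd := h d
    cases d with
    | zero => rw [(Submodule.mem_bot ℂ).1 hd, map_zero, Polynomial.coeff_zero]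
    -- An element of the previous step `d` has degree at most `2 * d`, hence no coefficient at `2 *
    -- (d + 1)`.
    | succ d =>
      exact Polynomial.coeff_eq_zero_of_natDegree_lt
        ((natDegree_scaleQ_le n (d := d) hd).trans_lt (by omega)))

theorem grToExt_symbol (d : ℕ) (a : qFil n 3 d) :
    grToExt n (Gr.symbol (qFil n 3) d a)
      = Polynomial.monomial d ((scaleQ n a).coeff (2 * d)) := by
  change topCoeff n (Polynomial.monomial d (a : Q (An n) 3)) = _
  ext1 e
  rw [coeff_topCoeff, Polynomial.coeff_monomial, Polynomial.coeff_monomial]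
  split_ifs with h
  · subst h; rfl
  · simp

/-- Evaluation at one of the polynomials over the exterior algebra. -/
def evalOneExt : (ExteriorAlgebra ℂ (Fin n → ℂ))[X] →ₐ[ℂ] ExteriorAlgebra ℂ (Fin n → ℂ) where
  toRingHom := Polynomial.eval₂RingHom' (RingHom.id _) 1 (fun a => Commute.one_right a)
  commutes' c := by
    change Polynomial.eval₂ (RingHom.id _) 1 _ = _
    rw [Polynomial.algebraMap_apply, Polynomial.eval₂_C]; rfl

theorem evalOneExt_monomial (d : ℕ) (a : ExteriorAlgebra ℂ (Fin n → ℂ)) :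
    evalOneExt n (Polynomial.monomial d a) = a := by
  change Polynomial.eval₂ (RingHom.id _) 1 _ = _
  simp [Polynomial.eval₂_monomial]

theorem lie_vec_mem_derivedLie (u v : Fin n → ℂ) : ⁅vec n u, vec n v⁆ ∈ derivedLie n :=
  Submodule.subset_span ⟨_, vec_mem_freeLie n u, _, vec_mem_freeLie n v, rfl⟩

/-- Top components recover the exterior product from the symbol of a commutator. -/
theorem evalOneExt_grToExt_derivedSymbol (u v : Fin n → ℂ) :
    evalOneExt n (grToExt n (derivedSymbol n 3 ⟨_, lie_vec_mem_derivedLie n u v⟩))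
      = (2 : ℂ) • (ExteriorAlgebra.ι ℂ u * ExteriorAlgebra.ι ℂ v) := by
  rw [derivedSymbol, LinearMap.comp_apply, grToExt_symbol, evalOneExt_monomial]
  change (scale (extGen n) ⁅vec n u, vec n v⁆).coeff 2 = _
  rw [scale_lie_vec, Polynomial.coeff_X_pow_mul' , if_pos le_rfl, Nat.sub_self,
    Polynomial.coeff_C_zero, linearCombination_extGen, linearCombination_extGen,
    LieRing.of_associative_ring_bracket, two_smul,
    ← sub_neg_eq_add (ExteriorAlgebra.ι ℂ u * ExteriorAlgebra.ι ℂ v)]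
  congr 1
  exact eq_neg_of_add_eq_zero_right (ExteriorAlgebra.ι_add_mul_swap u v)

end Exterior


/-! ### Symbols of commutators in D_4 and the ideal they span in Λ_4 -/

section Symbols

attribute [local instance] LieRing.ofAssociativeRing

theorem Gr.symbol_mul {A : Type*} [Ring A] [Algebra ℂ A] (F : ℕ → Submodule ℂ A)
    [IsRingFiltration F (below F)] (d e : ℕ) (a : F d) (b : F e) :
    Gr.symbol F d a * Gr.symbol F e b
      = Gr.symbol F (d + e) ⟨(a : A) * b, SetLike.GradedMul.mul_mem (A := F) a.2 b.2⟩ := by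
  refine (map_mul (Gr.mk F) _ _).symm.trans (congrArg (Gr.mk F) (Subtype.ext ?_))
  exact Polynomial.monomial_mul_monomial d e (a : A) (b : A)

theorem Gr.symbol_eq_zero {A : Type*} [Ring A] [Algebra ℂ A] (F : ℕ → Submodule ℂ A)
    [IsRingFiltration F (below F)] (d : ℕ) (a : F d) :
    Gr.symbol F d a = 0 ↔ (a : A) ∈ below F d := by
  refine (Gr.mk_eq_zero F).trans ⟨fun h => ?_, fun h e => ?_⟩
  · simpa using h d
  · change (Polynomial.monomial d (a : A)).coeff e ∈ _
    rw [Polynomial.coeff_monomial]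
    split_ifs with hde
    · exact hde ▸ h
    · exact zero_mem _

/-- Symbols of different degrees are linearly independent. -/
theorem Gr.symbol_eq_zero_of_add {A : Type*} [Ring A] [Algebra ℂ A] (F : ℕ → Submodule ℂ A)
    [IsRingFiltration F (below F)] {d e : ℕ} (hde : d ≠ e) (a : F d) (b : F e)
    (h : Gr.symbol F d a + Gr.symbol F e b = 0) : Gr.symbol F d a = 0 := by
  rw [Gr.symbol_eq_zero]
  have h1 := (Gr.mk_eq_zero F).1 ((map_add (Gr.mk F) _ _).trans h) d
  change (Polynomial.monomial d (a : A) + Polynomial.monomial e (b : A)).coeff d ∈ _ at h1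
  rwa [Polynomial.coeff_add, Polynomial.coeff_monomial_same,
    Polynomial.coeff_monomial_of_ne _ hde, add_zero] at h1

variable (n : ℕ)

theorem lie_lie_vec_mem_derivedLie (u v w : Fin n → ℂ) :
    ⁅⁅vec n u, vec n v⁆, vec n w⁆ ∈ derivedLie n :=
  Submodule.subset_span ⟨_, (freeLie n).lie_mem (vec_mem_freeLie n u) (vec_mem_freeLie n v), _,
    vec_mem_freeLie n w, rfl⟩

/-- The commutator of two vectors, as a bilinear map to the derived free Lie algebra. -/
def lieVec : (Fin n → ℂ) →ₗ[ℂ] (Fin n → ℂ) →ₗ[ℂ] derivedLie n :=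
  LinearMap.mk₂ ℂ (fun u v => ⟨⁅vec n u, vec n v⁆, lie_vec_mem_derivedLie n u v⟩)
    (fun _ _ _ => Subtype.ext (by simp)) (fun _ _ _ => Subtype.ext (by simp))
    (fun _ _ _ => Subtype.ext (by simp)) (fun _ _ _ => Subtype.ext (by simp))

/-- The symbol of the commutator of two vectors. -/
def lieSym (i : ℕ) : (Fin n → ℂ) →ₗ[ℂ] (Fin n → ℂ) →ₗ[ℂ] D n i :=
  (lieVec n).compr₂ (derivedSymbol n i)

/-- The symbol of the triple commutator of vectors. -/
def lieLieSym (i : ℕ) (u v w : Fin n → ℂ) : D n i :=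
  derivedSymbol n i ⟨_, lie_lie_vec_mem_derivedLie n u v w⟩

variable {n}

theorem lieSym_apply (i : ℕ) (u v : Fin n → ℂ) :
    lieSym n i u v = derivedSymbol n i ⟨_, lie_vec_mem_derivedLie n u v⟩ := rfl

theorem derivedSymbol_congr {i : ℕ} {a b : derivedLie n}
    (h : Q.mk (An n) i a = Q.mk (An n) i b) : derivedSymbol n i a = derivedSymbol n i b :=
  congrArg (Gr.symbol (qFil n i) 1) (Subtype.ext h)

theorem derivedSymbol_mul (i : ℕ) (a b : derivedLie n) :
    derivedSymbol n i a * derivedSymbol n i b = Gr.symbol (qFil n i) 2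
      ⟨Q.mk (An n) i a * Q.mk (An n) i b, SetLike.GradedMul.mul_mem (A := qFil n i)
        (mk_mem_qFil_one n i a) (mk_mem_qFil_one n i b)⟩ :=
  Gr.symbol_mul (qFil n i) 1 1 _ _

theorem derivedSymbol_mul_eq_zero {i : ℕ} {a b : derivedLie n}
    (h : Q.mk (An n) i a * Q.mk (An n) i b = 0) :
    derivedSymbol n i a * derivedSymbol n i b = 0 := by
  rw [derivedSymbol_mul, ← map_zero (Gr.symbol (qFil n i) 2)]
  exact congrArg (Gr.symbol (qFil n i) 2) (Subtype.ext h)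

theorem derivedSymbol_mul_comm {i : ℕ} {a b : derivedLie n}
    (h : Q.mk (An n) i a * Q.mk (An n) i b = Q.mk (An n) i b * Q.mk (An n) i a) :
    derivedSymbol n i a * derivedSymbol n i b = derivedSymbol n i b * derivedSymbol n i a := by
  rw [derivedSymbol_mul, derivedSymbol_mul]
  exact congrArg (Gr.symbol (qFil n i) 2) (Subtype.ext h)

theorem lieSym_mul_comm (a b c d : Fin n → ℂ) :
    lieSym n 4 a b * lieSym n 4 c d = lieSym n 4 c d * lieSym n 4 a b := by
  refine derivedSymbol_mul_comm ?_
  change Q.mk (An n) 4 ⁅vec n a, vec n b⁆ * Q.mk (An n) 4 ⁅vec n c, vec n d⁆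
    = Q.mk (An n) 4 ⁅vec n c, vec n d⁆ * Q.mk (An n) 4 ⁅vec n a, vec n b⁆
  rw [Q.mk_lie, Q.mk_lie]
  exact lie_mul_lie_comm Q_four_lie_lie_lie _ _ _ _

theorem lieLieSym_mul_lieSym (a b c d e : Fin n → ℂ) :
    lieLieSym n 4 a b c * lieSym n 4 d e = 0 := by
  refine derivedSymbol_mul_eq_zero ?_
  change Q.mk (An n) 4 _ * Q.mk (An n) 4 ⁅vec n d, vec n e⁆ = 0
  rw [Q.mk_lie, Q.mk_lie, Q.mk_lie]
  exact lie_lie_mul_lie Q_four_lie_lie_lie _ _ _ _ _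

theorem lieSym_mul_lieLieSym (a b c d e : Fin n → ℂ) :
    lieSym n 4 d e * lieLieSym n 4 a b c = 0 := by
  rw [← lieLieSym_mul_lieSym a b c d e]
  refine derivedSymbol_mul_comm ?_
  rw [Q.mk_lie, Q.mk_lie]
  exact (lie_lie_comm Q_four_lie_lie_lie _ _ _ _).symm

theorem lieLieSym_mul_lieLieSym (a b c d e f : Fin n → ℂ) :
    lieLieSym n 4 a b c * lieLieSym n 4 d e f = 0 := by
  refine derivedSymbol_mul_eq_zero ?_
  rw [Q.mk_lie, Q.mk_lie, Q.mk_lie _ ⁅vec n d, vec n e⁆]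
  exact lie_lie_mul_lie Q_four_lie_lie_lie _ _ _ _ _

/-- The symbol of `[a,c][b,d] + [a,d][b,c]`. -/
def plucker (i : ℕ) (a b c d : Fin n → ℂ) : D n i :=
  lieSym n i a c * lieSym n i b d + lieSym n i a d * lieSym n i b c

theorem plucker_mul_lieSym (a b c d e f : Fin n → ℂ) :
    plucker 4 a b c d * lieSym n 4 e f = 0 := by
  rw [plucker, add_mul]
  simp only [lieSym_apply, derivedSymbol_mul]
  simp only [derivedSymbol, LinearMap.comp_apply, Gr.symbol_mul]
  rw [← map_add, ← map_zero (Gr.symbol (qFil n 4) (2 + 1))]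
  refine congrArg (Gr.symbol (qFil n 4) (2 + 1)) (Subtype.ext ?_)
  have h := lie_mul_lie_add_mul_lie Q_four_lie_lie_lie (Q.mk (An n) 4 (vec n a))
    (Q.mk (An n) 4 (vec n b)) (Q.mk (An n) 4 (vec n c)) (Q.mk (An n) 4 (vec n d))
    (Q.mk (An n) 4 (vec n e)) (Q.mk (An n) 4 (vec n f))
  simp only [← Q.mk_lie, add_mul] at h
  exact h

theorem lieSym_mul_plucker (a b c d e f : Fin n → ℂ) :
    lieSym n 4 e f * plucker 4 a b c d = 0 := by
  rw [← plucker_mul_lieSym a b c d e f, plucker, mul_add, add_mul]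
  congr 1
  · rw [← mul_assoc, lieSym_mul_comm e f, mul_assoc, lieSym_mul_comm e f, mul_assoc]
  · rw [← mul_assoc, lieSym_mul_comm e f, mul_assoc, lieSym_mul_comm e f, mul_assoc]

variable (n) in
/-- The span of the symbols of triple commutators of vectors. -/
def tripleSpan : Submodule ℂ (D n 4) :=
  Submodule.span ℂ {x | ∃ a b c, lieLieSym n 4 a b c = x}

variable (n) in
/-- The span of the symbols of `[a,c][b,d] + [a,d][b,c]`. -/
def pluckerSpan : Submodule ℂ (D n 4) :=
  Submodule.span ℂ {x | ∃ a b c d, plucker 4 a b c d = x}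

variable (n) in
/-- The span of the symbols of commutators of vectors. -/
def lieSpan : Submodule ℂ (D n 4) :=
  Submodule.span ℂ {x | ∃ a b, lieSym n 4 a b = x}

/-- A symbol depends only on the class modulo M_4, where ℓ_n' reduces to double and triple
commutators of vectors. -/
theorem derivedSymbol_mem (a : derivedLie n) :
    derivedSymbol n 4 a ∈ lieSpan n ⊔ tripleSpan n := by
  obtain ⟨m, hm, hma⟩ := mk_mem_of_mem_derivedLie n a.2
  have hle : lieTwo n ⊔ lieThree n ≤ ((lieSpan n ⊔ tripleSpan n).comap
      (derivedSymbol n 4)).map (derivedLie n).subtype := by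
    refine sup_le (Submodule.span_le.2 ?_) (Submodule.span_le.2 ?_)
    · rintro _ ⟨u, v, rfl⟩
      exact ⟨⟨_, lie_vec_mem_derivedLie n u v⟩,
        Submodule.mem_sup_left (Submodule.subset_span ⟨u, v, rfl⟩), rfl⟩
    · rintro _ ⟨u, v, w, rfl⟩
      exact ⟨⟨_, lie_lie_vec_mem_derivedLie n u v w⟩,
        Submodule.mem_sup_right (Submodule.subset_span ⟨u, v, w, rfl⟩), rfl⟩
  obtain ⟨a', ha', rfl⟩ := hle hm
  rw [derivedSymbol_congr (a := a) (b := a') hma.symm]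
  exact ha'

theorem derivedSymbol_mem_Lam (i : ℕ) (a : derivedLie n) : derivedSymbol n i a ∈ Lam n i :=
  Algebra.subset_adjoin ⟨a, rfl⟩

theorem lieSym_mem_Lam (i : ℕ) (u v : Fin n → ℂ) : lieSym n i u v ∈ Lam n i :=
  derivedSymbol_mem_Lam i _

theorem tripleSpan_le_Lam : tripleSpan n ≤ (Lam n 4).toSubmodule := by
  refine Submodule.span_le.2 ?_
  rintro _ ⟨a, b, c, rfl⟩
  exact derivedSymbol_mem_Lam 4 _

theorem pluckerSpan_le_Lam : pluckerSpan n ≤ (Lam n 4).toSubmodule := by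
  refine Submodule.span_le.2 ?_
  rintro _ ⟨a, b, c, d, rfl⟩
  exact (Lam n 4).add_mem ((Lam n 4).mul_mem (lieSym_mem_Lam 4 _ _) (lieSym_mem_Lam 4 _ _))
    ((Lam n 4).mul_mem (lieSym_mem_Lam 4 _ _) (lieSym_mem_Lam 4 _ _))

/-- By linearity only products of the two kinds of generator with the two kinds of spanning element
occur, and the commutator identities kill them all. So on this span Λ_4 acts through scalars, and
the span is an ideal. -/
theorem derivedSymbol_mul_eq_zero_of_mem (a : derivedLie n) {x : D n 4}
    (hx : x ∈ tripleSpan n ⊔ pluckerSpan n) :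
    derivedSymbol n 4 a * x = 0 ∧ x * derivedSymbol n 4 a = 0 := by
  have hle : tripleSpan n ⊔ pluckerSpan n ≤
      LinearMap.ker (LinearMap.mulLeft ℂ (derivedSymbol n 4 a)) ⊓
      LinearMap.ker (LinearMap.mulRight ℂ (derivedSymbol n 4 a)) := by
    have key : ∀ z ∈ lieSpan n ⊔ tripleSpan n, ∀ y : D n 4,
        (∀ u v, lieSym n 4 u v * y = 0 ∧ y * lieSym n 4 u v = 0) →
        (∀ u v w, lieLieSym n 4 u v w * y = 0 ∧ y * lieLieSym n 4 u v w = 0) →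
        z * y = 0 ∧ y * z = 0 := by
      intro z hz y h2 h3
      have : lieSpan n ⊔ tripleSpan n ≤
          LinearMap.ker (LinearMap.mulRight ℂ y) ⊓ LinearMap.ker (LinearMap.mulLeft ℂ y) := by
        refine sup_le (Submodule.span_le.2 ?_) (Submodule.span_le.2 ?_)
        · rintro _ ⟨u, v, rfl⟩; exact h2 u v
        · rintro _ ⟨u, v, w, rfl⟩; exact h3 u v w
      exact this hz
    refine sup_le (Submodule.span_le.2 ?_) (Submodule.span_le.2 ?_)
    · rintro _ ⟨b, c, d, rfl⟩
      exact key _ (derivedSymbol_mem a) _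
        (fun _ _ => ⟨lieSym_mul_lieLieSym .., lieLieSym_mul_lieSym ..⟩)
        (fun _ _ _ => ⟨lieLieSym_mul_lieLieSym .., lieLieSym_mul_lieLieSym ..⟩)
    · rintro _ ⟨b, c, d, e, rfl⟩
      refine key _ (derivedSymbol_mem a) _
        (fun _ _ => ⟨lieSym_mul_plucker .., plucker_mul_lieSym ..⟩) (fun _ _ _ => ⟨?_, ?_⟩)
      · rw [plucker, mul_add, ← mul_assoc, ← mul_assoc, lieLieSym_mul_lieSym,
          lieLieSym_mul_lieSym, zero_mul, zero_mul, add_zero]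
      · rw [plucker, add_mul, mul_assoc, mul_assoc, lieSym_mul_lieLieSym, lieSym_mul_lieLieSym,
          mul_zero, mul_zero, add_zero]
  exact hle hx

theorem mul_mem_of_mem_Lam {z : D n 4} (hz : z ∈ Lam n 4) :
    ∀ x ∈ tripleSpan n ⊔ pluckerSpan n,
      z * x ∈ tripleSpan n ⊔ pluckerSpan n ∧ x * z ∈ tripleSpan n ⊔ pluckerSpan n := by
  rw [Lam] at hz
  induction hz using Algebra.adjoin_induction with
  | mem y hy =>
    obtain ⟨a, rfl⟩ := hy
    intro x hx
    rw [(derivedSymbol_mul_eq_zero_of_mem a hx).1, (derivedSymbol_mul_eq_zero_of_mem a hx).2]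
    exact ⟨zero_mem _, zero_mem _⟩
  | algebraMap r =>
    intro x hx
    rw [← Algebra.commutes, Algebra.algebraMap_eq_smul_one, smul_mul_assoc, one_mul]
    exact ⟨Submodule.smul_mem _ _ hx, Submodule.smul_mem _ _ hx⟩
  | add y y' _ _ h h' =>
    intro x hx
    rw [add_mul, mul_add]
    exact ⟨add_mem (h x hx).1 (h' x hx).1, add_mem (h x hx).2 (h' x hx).2⟩
  | mul y y' _ _ h h' =>
    intro x hx
    rw [mul_assoc, ← mul_assoc x]
    exact ⟨(h _ (h' x hx).1).1, (h' _ (h x hx).2).2⟩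

/-! ### The kernel of the projection to `D_3` -/

theorem projD_derivedSymbol (i : ℕ) (a : derivedLie n) :
    projD n i (derivedSymbol n (i + 1) a) = derivedSymbol n i a :=
  Gr.map_symbol _ (proj_mem_qFil i) 1 ⟨Q.mk (An n) (i + 1) a, mk_mem_qFil_one n (i + 1) a⟩

theorem projD_eq_zero_of_mem {x : D n 4} (hx : x ∈ tripleSpan n ⊔ pluckerSpan n) :
    projD n 3 x = 0 := by
  suffices h : tripleSpan n ⊔ pluckerSpan n ≤ LinearMap.ker (projD n 3).toLinearMap from h hx
  refine sup_le (Submodule.span_le.2 ?_) (Submodule.span_le.2 ?_)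
  · rintro _ ⟨a, b, c, rfl⟩
    change projD n 3 (derivedSymbol n 4 _) = 0
    rw [projD_derivedSymbol, ← map_zero (derivedSymbol n 3)]
    refine derivedSymbol_congr ?_
    rw [Q.mk_lie, Q.mk_lie, ← lie_skew, Q_three_lie_lie, neg_zero]
    simp
  · rintro _ ⟨a, b, c, d, rfl⟩
    change projD n 3 (plucker 4 a b c d) = 0
    rw [plucker]
    simp only [lieSym_apply, map_add, map_mul]
    simp only [projD_derivedSymbol, derivedSymbol_mul]
    rw [← map_add, ← map_zero (Gr.symbol (qFil n 3) 2)]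
    refine congrArg (Gr.symbol (qFil n 3) 2) (Subtype.ext ?_)
    have h := lie_mul_lie_add_eq_zero Q_three_lie_lie (Q.mk (An n) 3 (vec n a))
      (Q.mk (An n) 3 (vec n b)) (Q.mk (An n) 3 (vec n c)) (Q.mk (An n) 3 (vec n d))
    simp only [← Q.mk_lie] at h
    exact h

variable (n) in
/-- The ideal of `Λ_4` spanned by the symbols of triple commutators and by the Plücker symbols. -/
def kerIdeal : TwoSidedIdeal (Lam n 4) :=
  TwoSidedIdeal.mk' {z | (z : D n 4) ∈ tripleSpan n ⊔ pluckerSpan n}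
    (tripleSpan n ⊔ pluckerSpan n).zero_mem
    (fun h h' => (tripleSpan n ⊔ pluckerSpan n).add_mem h h') (fun h => (tripleSpan n ⊔ pluckerSpan n).neg_mem h)
    (fun {x y} h => (mul_mem_of_mem_Lam x.2 y h).1) (fun {x y} h => (mul_mem_of_mem_Lam y.2 x h).2)

theorem mem_kerIdeal {z : Lam n 4} :
    z ∈ kerIdeal n ↔ (z : D n 4) ∈ tripleSpan n ⊔ pluckerSpan n :=
  TwoSidedIdeal.mem_mk' ..

variable (n) in
/-- The quotient of `Λ_4` by `kerIdeal`. -/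
abbrev LamQuot : Type := (kerIdeal n).ringCon.Quotient

variable (n) in
/-- The quotient map. -/
def LamQuot.mk : Lam n 4 →ₐ[ℂ] LamQuot n := RingCon.mkₐ ℂ (kerIdeal n).ringCon

theorem LamQuot.mk_eq_zero {z : Lam n 4} :
    LamQuot.mk n z = 0 ↔ (z : D n 4) ∈ tripleSpan n ⊔ pluckerSpan n := by
  rw [← mem_kerIdeal, TwoSidedIdeal.mem_iff]
  exact Quotient.eq''

variable (n) in
/-- The symbol of the commutator of two vectors, in `Λ_4`. -/
def lieLam : (Fin n → ℂ) →ₗ[ℂ] (Fin n → ℂ) →ₗ[ℂ] Lam n 4 :=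
  LinearMap.mk₂ ℂ (fun u v => ⟨lieSym n 4 u v, lieSym_mem_Lam 4 u v⟩)
    (fun _ _ _ => Subtype.ext (by simp)) (fun _ _ _ => Subtype.ext (by simp))
    (fun _ _ _ => Subtype.ext (by simp)) (fun _ _ _ => Subtype.ext (by simp))

theorem lieSym_self (i : ℕ) (u : Fin n → ℂ) : lieSym n i u u = 0 := by
  rw [lieSym_apply, ← map_zero (derivedSymbol n i)]
  exact congrArg (derivedSymbol n i) (Subtype.ext (lie_self _))

theorem lieSym_swap (i : ℕ) (u v : Fin n → ℂ) : lieSym n i v u = -lieSym n i u v := by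
  rw [lieSym_apply, lieSym_apply, ← map_neg]
  exact congrArg (derivedSymbol n i) (Subtype.ext (lie_skew _ _).symm)

variable (n) in
/-- The homomorphism from the even exterior algebra to `LamQuot`. -/
def evenToLamQuot : EvenExt n →ₐ[ℂ] LamQuot n :=
  CliffordAlgebra.even.lift _
    -- The factor 1/2 compensates for [u,v] = 2uv in the exterior algebra. For the zero form the
    -- required relations are f(u,u) = 0 and f(u,v) f(v,w) = 0.
    { bilin := (2⁻¹ : ℂ) • (lieLam n).compr₂ (LamQuot.mk n).toLinearMap
      contract := fun u => by
        have : lieLam n u u = 0 := Subtype.ext (lieSym_self 4 u)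
        simp [this]
      contract_mid := fun u v w => by
        have h : LamQuot.mk n (lieLam n u v * lieLam n v w) = 0 := by
          rw [LamQuot.mk_eq_zero]
          refine Submodule.mem_sup_right ?_
          -- Repeating the last argument makes both terms of the Plücker symbol equal to
          -- `-[u,v][v,w]`.
          have h1 : plucker 4 u w v v ∈ pluckerSpan n := Submodule.subset_span ⟨_, _, _, _, rfl⟩
          have h2 : plucker 4 u w v v = (-2 : ℂ) • (lieSym n 4 u v * lieSym n 4 v w) := by
            rw [plucker, lieSym_swap 4 v w, mul_neg, neg_smul, two_smul]; abel
          rw [h2] at h1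
          exact (Submodule.smul_mem_iff _ (by norm_num)).1 h1
        rw [map_mul] at h
        simp [h] }

theorem evenToLamQuot_ι (u v : Fin n → ℂ) :
    evenToLamQuot n ((CliffordAlgebra.even.ι _).bilin u v)
      = (2⁻¹ : ℂ) • LamQuot.mk n (lieLam n u v) :=
  CliffordAlgebra.even.lift_ι ..

theorem mk_mem_range_evenToLamQuot (z : Lam n 4) :
    LamQuot.mk n z ∈ (evenToLamQuot n).range := by
  -- The preimage of the range is pushed forward to `D n 4`, where `Lam n 4` is defined by
  -- generators and minimality applies.
  let S : Subalgebra ℂ (D n 4) :=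
    (((evenToLamQuot n).range).comap (LamQuot.mk n)).map (Lam n 4).val
  have hS : Lam n 4 ≤ S := by
    refine Algebra.adjoin_le ?_
    rintro _ ⟨a, rfl⟩
    have hle : lieSpan n ⊔ tripleSpan n ≤ S.toSubmodule := by
      refine sup_le (Submodule.span_le.2 ?_) (Submodule.span_le.2 ?_)
      · rintro _ ⟨u, v, rfl⟩
        refine ⟨lieLam n u v, ?_, rfl⟩
        refine ⟨(2 : ℂ) • (CliffordAlgebra.even.ι _).bilin u v, ?_⟩
        change evenToLamQuot n _ = LamQuot.mk n _
        rw [map_smul, evenToLamQuot_ι, smul_smul]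
        norm_num
      · intro x hx
        have hx' : x ∈ tripleSpan n := Submodule.subset_span hx
        refine ⟨⟨x, tripleSpan_le_Lam hx'⟩, ?_, rfl⟩
        change LamQuot.mk n _ ∈ (evenToLamQuot n).range
        rw [LamQuot.mk_eq_zero.2 (Submodule.mem_sup_left hx')]
        exact zero_mem _
    exact hle (derivedSymbol_mem a)
  obtain ⟨y, hy, hyz⟩ := hS z.2
  have : y = z := Subtype.ext hyz
  exact this ▸ hy

variable (n) in
/-- The projection to `D_3` factors through `LamQuot`. -/
def LamQuot.proj : LamQuot n →ₐ[ℂ] D n 3 :=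
  RingCon.liftₐ _ ((projD n 3).comp (Lam n 4).val) (by
    intro x y hxy
    have h := mem_kerIdeal.1 ((TwoSidedIdeal.rel_iff _ _ _).1 hxy)
    refine (RingCon.ker_apply _).2 (sub_eq_zero.1 ?_)
    rw [← map_sub]
    exact projD_eq_zero_of_mem h)

theorem LamQuot.proj_mk (z : Lam n 4) : LamQuot.proj n (LamQuot.mk n z) = projD n 3 z := rfl

/-- Homomorphisms out of the even algebra are determined on products of two vectors, where the
factor 1/2 cancels the 2 of the commutator. The consequence needed is that an element of the even
algebra dying in D_3 is zero. -/
theorem evalOneExt_comp (x : EvenExt n) :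
    evalOneExt n (grToExt n (LamQuot.proj n (evenToLamQuot n x))) = x := by
  suffices h : (((evalOneExt n).comp (grToExt n)).comp (LamQuot.proj n)).comp (evenToLamQuot n)
      = (CliffordAlgebra.even (0 : QuadraticForm ℂ (Fin n → ℂ))).val from
    DFunLike.congr_fun h x
  refine CliffordAlgebra.even.algHom_ext _ (CliffordAlgebra.EvenHom.ext ?_)
  refine LinearMap.ext₂ fun u v => ?_
  change evalOneExt n (grToExt n (LamQuot.proj n (evenToLamQuot n _))) = _
  rw [evenToLamQuot_ι, map_smul, map_smul, map_smul, LamQuot.proj_mk]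
  change (2⁻¹ : ℂ) • evalOneExt n (grToExt n (projD n 3 (derivedSymbol n 4 _))) = _
  rw [projD_derivedSymbol]
  refine (congrArg _ (evalOneExt_grToExt_derivedSymbol n u v)).trans ?_
  rw [smul_smul, inv_mul_cancel₀ two_ne_zero, one_smul]
  rfl

/-- The kernel of `Λ_4 → Λ_3` is spanned by the symbols of triple commutators of vectors and by the
Plücker symbols. -/
theorem mem_of_projD_eq_zero {x : D n 4} (hx : x ∈ Lam n 4) (h : projD n 3 x = 0) :
    x ∈ tripleSpan n ⊔ pluckerSpan n := by
  -- Lift the class of `x` to the even algebra; its image in D_3 is that of `x`, namely zero, so the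
  -- lift vanishes and `x` lies in the ideal.
  obtain ⟨e, he⟩ := mk_mem_range_evenToLamQuot ⟨x, hx⟩
  have he' : evenToLamQuot n e = LamQuot.mk n ⟨x, hx⟩ := he
  have h1 := evalOneExt_comp e
  rw [he', LamQuot.proj_mk] at h1
  change evalOneExt n (grToExt n (projD n 3 x)) = _ at h1
  rw [h, map_zero, map_zero] at h1
  have h2 : e = 0 := Subtype.ext h1.symm
  rw [h2, map_zero] at he'
  exact LamQuot.mk_eq_zero.1 he'.symm

end Symbols


/-! ### Identification of the two spans with Schur modules -/

section Schur

attribute [local instance] LieRing.ofAssociativeRing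

variable {n : ℕ}

/-- The cell `(0,0)` of the diagram of `(2,1)`. -/
def a00 : diagram21.cells := ⟨(0, 0), by decide +kernel⟩
/-- The cell `(0,1)` of the diagram of `(2,1)`. -/
def a01 : diagram21.cells := ⟨(0, 1), by decide +kernel⟩
/-- The cell `(1,0)` of the diagram of `(2,1)`. -/
def a10 : diagram21.cells := ⟨(1, 0), by decide +kernel⟩
/-- The cell `(0,0)` of the diagram of `(2,2)`. -/
def b00 : diagram22.cells := ⟨(0, 0), by decide +kernel⟩
/-- The cell `(0,1)` of the diagram of `(2,2)`. -/
def b01 : diagram22.cells := ⟨(0, 1), by decide +kernel⟩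
/-- The cell `(1,0)` of the diagram of `(2,2)`. -/
def b10 : diagram22.cells := ⟨(1, 0), by decide +kernel⟩
/-- The cell `(1,1)` of the diagram of `(2,2)`. -/
def b11 : diagram22.cells := ⟨(1, 1), by decide +kernel⟩

theorem eq_cell_diagram21 : ∀ c : diagram21.cells, c = a00 ∨ c = a01 ∨ c = a10 := by
  decide +kernel
theorem eq_cell_diagram22 : ∀ c : diagram22.cells, c = b00 ∨ c = b01 ∨ c = b10 ∨ c = b11 := by
  decide +kernel

theorem ne_cell_diagram21 : a00 ≠ a01 ∧ a00 ≠ a10 ∧ a01 ≠ a10 ∧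
    a01 ≠ a00 ∧ a10 ≠ a00 ∧ a10 ≠ a01 := by decide +kernel
theorem ne_cell_diagram22 : b00 ≠ b01 ∧ b00 ≠ b10 ∧ b00 ≠ b11 ∧ b01 ≠ b10 ∧ b01 ≠ b11 ∧
    b10 ≠ b11 ∧ b01 ≠ b00 ∧ b10 ≠ b00 ∧ b11 ≠ b00 ∧ b10 ≠ b01 ∧ b11 ≠ b01 ∧ b11 ≠ b10 := by
  decide +kernel

theorem rowPerms_diagram21 : rowPerms diagram21 = {1, Equiv.swap a00 a01} := by decide +kernel
theorem colPerms_diagram21 : colPerms diagram21 = {1, Equiv.swap a00 a10} := by decide +kernel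
theorem rowPerms_diagram22 : rowPerms diagram22 =
    {1, Equiv.swap b00 b01, Equiv.swap b10 b11, Equiv.swap b00 b01 * Equiv.swap b10 b11} := by
  decide +kernel
theorem colPerms_diagram22 : colPerms diagram22 =
    {1, Equiv.swap b00 b10, Equiv.swap b01 b11, Equiv.swap b00 b10 * Equiv.swap b01 b11} := by
  decide +kernel

theorem sum_rowPerms_diagram21 {W : Type*} [AddCommMonoid W] (f : Equiv.Perm diagram21.cells → W) :
    ∑ σ ∈ rowPerms diagram21, f σ = f 1 + f (Equiv.swap a00 a01) := by
  rw [rowPerms_diagram21, Finset.sum_pair (by decide +kernel)]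

theorem sum_colPerms_diagram21 {W : Type*} [AddCommMonoid W] (f : Equiv.Perm diagram21.cells → W) :
    ∑ σ ∈ colPerms diagram21, f σ = f 1 + f (Equiv.swap a00 a10) := by
  rw [colPerms_diagram21, Finset.sum_pair (by decide +kernel)]

theorem sum_rowPerms_diagram22 {W : Type*} [AddCommMonoid W] (f : Equiv.Perm diagram22.cells → W) :
    ∑ σ ∈ rowPerms diagram22, f σ = f 1 + (f (Equiv.swap b00 b01) + (f (Equiv.swap b10 b11) +
      f (Equiv.swap b00 b01 * Equiv.swap b10 b11))) := by
  rw [rowPerms_diagram22, Finset.sum_insert (by decide +kernel),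
    Finset.sum_insert (by decide +kernel), Finset.sum_pair (by decide +kernel)]

theorem sum_colPerms_diagram22 {W : Type*} [AddCommMonoid W] (f : Equiv.Perm diagram22.cells → W) :
    ∑ σ ∈ colPerms diagram22, f σ = f 1 + (f (Equiv.swap b00 b10) + (f (Equiv.swap b01 b11) +
      f (Equiv.swap b00 b10 * Equiv.swap b01 b11))) := by
  rw [colPerms_diagram22, Finset.sum_insert (by decide +kernel),
    Finset.sum_insert (by decide +kernel), Finset.sum_pair (by decide +kernel)]

variable (n) in
/-- The map sending a tensor of shape `(2,1)` to the symbol of a triple commutator. -/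
def tripleMap : CellTensor diagram21 n →ₗ[ℂ] D n 4 :=
  PiTensorProduct.lift
    { toFun := fun v => lieLieSym n 4 (v a00) (v a10) (v a01)
      map_update_add' := by
        obtain ⟨h1, h2, h3, h4, h5, h6⟩ := ne_cell_diagram21
        intro _ v c x y
        rw [lieLieSym, lieLieSym, lieLieSym, ← map_add]
        refine congrArg (derivedSymbol n 4) (Subtype.ext ?_)
        rcases eq_cell_diagram21 c with rfl | rfl | rfl <;>
          simp [h1, h2, h3, h4, h5, h6]
      map_update_smul' := by
        obtain ⟨h1, h2, h3, h4, h5, h6⟩ := ne_cell_diagram21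
        intro _ v c r x
        rw [lieLieSym, lieLieSym, ← map_smul]
        refine congrArg (derivedSymbol n 4) (Subtype.ext ?_)
        rcases eq_cell_diagram21 c with rfl | rfl | rfl <;>
          simp [h1, h2, h3, h4, h5, h6] }

variable (n) in
/-- The map sending a tensor of shape `(2,2)` to the symbol of a product of commutators. -/
def pairMap : CellTensor diagram22 n →ₗ[ℂ] D n 4 :=
  PiTensorProduct.lift
    { toFun := fun v => lieSym n 4 (v b00) (v b10) * lieSym n 4 (v b01) (v b11)
      map_update_add' := by
        obtain ⟨h1, h2, h3, h4, h5, h6, h7, h8, h9, h10, h11, h12⟩ := ne_cell_diagram22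
        intro _ v c x y
        rcases eq_cell_diagram22 c with rfl | rfl | rfl | rfl <;>
          simp [h1, h2, h3, h4, h5, h6, h7, h8, h9, h10, h11, h12, add_mul, mul_add]
      map_update_smul' := by
        obtain ⟨h1, h2, h3, h4, h5, h6, h7, h8, h9, h10, h11, h12⟩ := ne_cell_diagram22
        intro _ v c r x
        rcases eq_cell_diagram22 c with rfl | rfl | rfl | rfl <;>
          simp [h1, h2, h3, h4, h5, h6, h7, h8, h9, h10, h11, h12] }

theorem tripleMap_tprod (v : diagram21.cells → Fin n → ℂ) :
    tripleMap n (PiTensorProduct.tprod ℂ v) = lieLieSym n 4 (v a00) (v a10) (v a01) :=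
  PiTensorProduct.lift.tprod v

theorem pairMap_tprod (v : diagram22.cells → Fin n → ℂ) :
    pairMap n (PiTensorProduct.tprod ℂ v)
      = lieSym n 4 (v b00) (v b10) * lieSym n 4 (v b01) (v b11) :=
  PiTensorProduct.lift.tprod v

theorem lieLieSym_antisymm (a b c : Fin n → ℂ) : lieLieSym n 4 b a c = -lieLieSym n 4 a b c := by
  rw [lieLieSym, lieLieSym, ← map_neg]
  refine congrArg (derivedSymbol n 4) (Subtype.ext ?_)
  change _ = -⁅⁅vec n a, vec n b⁆, vec n c⁆
  rw [← neg_lie, lie_skew]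

theorem lieLieSym_jacobi (a b c : Fin n → ℂ) :
    lieLieSym n 4 a b c + lieLieSym n 4 b c a + lieLieSym n 4 c a b = 0 := by
  rw [lieLieSym, lieLieSym, lieLieSym, ← map_add, ← map_add, ← map_zero (derivedSymbol n 4)]
  refine congrArg (derivedSymbol n 4) (Subtype.ext ?_)
  change ⁅⁅vec n a, vec n b⁆, vec n c⁆ + ⁅⁅vec n b, vec n c⁆, vec n a⁆
    + ⁅⁅vec n c, vec n a⁆, vec n b⁆ = 0
  simp only [LieRing.of_associative_ring_bracket]
  noncomm_ring

/-- Antisymmetry in the column and the Jacobi identity are exactly the relations under which the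
symmetrizer acts by its hook product 3. So restricting to F_(2,1) loses nothing of the image. -/
theorem tripleMap_youngSymmetrizer (t : CellTensor diagram21 n) :
    tripleMap n (youngSymmetrizer diagram21 n t) = (3 : ℂ) • tripleMap n t := by
  suffices h : tripleMap n ∘ₗ youngSymmetrizer diagram21 n = (3 : ℂ) • tripleMap n from
    LinearMap.congr_fun h t
  refine PiTensorProduct.ext (MultilinearMap.ext fun v => ?_)
  obtain ⟨h1, h2, h3, h4, h5, h6⟩ := ne_cell_diagram21
  have hs : ∀ c d : diagram21.cells, ∀ e, c ≠ e → d ≠ e → Equiv.swap c d e = e :=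
    fun c d e h h' => Equiv.swap_apply_of_ne_of_ne h.symm h'.symm
  simp only [LinearMap.compMultilinearMap_apply, LinearMap.comp_apply, LinearMap.smul_apply,
    youngSymmetrizer_apply, rowSum, colSum, sum_rowPerms_diagram21, sum_colPerms_diagram21,
    LinearMap.add_apply, map_add, map_smul, permCells_tprod, tripleMap_tprod, inv_one,
    Equiv.Perm.one_apply, Equiv.swap_inv, Equiv.Perm.sign_one, Equiv.Perm.sign_swap h2,
    Equiv.swap_apply_left, Equiv.swap_apply_right, hs a00 a01 a10 h2 h3, hs a00 a10 a01 h1 h6]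
  generalize v a00 = a
  generalize v a01 = b
  generalize v a10 = c
  have hj := lieLieSym_jacobi a c b
  rw [lieLieSym_antisymm b c a, lieLieSym_antisymm a b c] at hj
  -- Jacobi removes one of the three orderings, leaving two to be compared as independent symbols.
  have hb : lieLieSym n 4 a b c = lieLieSym n 4 a c b - lieLieSym n 4 b c a := by
    rw [← sub_eq_zero, ← neg_eq_zero, ← hj]; abel
  simp only [lieLieSym_antisymm a c b, lieLieSym_antisymm a b c, hb,
    Units.val_one, Units.val_neg, Int.cast_one, Int.cast_neg]
  module

theorem pairMap_youngSymmetrizer (v : diagram22.cells → Fin n → ℂ) :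
    pairMap n (youngSymmetrizer diagram22 n (PiTensorProduct.tprod ℂ v)) =
      (4 : ℂ) • plucker 4 (v b00) (v b01) (v b10) (v b11)
      - (4 : ℂ) • plucker 4 (v b00) (v b11) (v b10) (v b01) := by
  obtain ⟨h1, h2, h3, h4, h5, h6, h7, h8, h9, h10, h11, h12⟩ := ne_cell_diagram22
  have hs : ∀ c d : diagram22.cells, ∀ e, c ≠ e → d ≠ e → Equiv.swap c d e = e :=
    fun c d e h h' => Equiv.swap_apply_of_ne_of_ne h.symm h'.symm
  simp only [youngSymmetrizer_apply, rowSum, colSum, sum_rowPerms_diagram22,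
    sum_colPerms_diagram22, LinearMap.smul_apply,
    LinearMap.add_apply, map_add, map_smul, permCells_tprod, pairMap_tprod, inv_one, mul_inv_rev,
    Equiv.Perm.one_apply, Equiv.swap_inv, Equiv.Perm.sign_one, Equiv.Perm.sign_mul,
    Equiv.Perm.sign_swap h2, Equiv.Perm.sign_swap h5, Equiv.Perm.mul_apply,
    Equiv.swap_apply_left, Equiv.swap_apply_right, hs b00 b01 b10 h2 h4, hs b00 b01 b11 h3 h5,
    hs b10 b11 b00 h8 h9, hs b10 b11 b01 h10 h11, hs b00 b10 b01 h1 h10, hs b00 b10 b11 h3 h6,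
    hs b01 b11 b00 h7 h9, hs b01 b11 b10 h4 h12]
  generalize v b00 = a
  generalize v b01 = b
  generalize v b10 = c
  generalize v b11 = d
  simp only [plucker, lieSym_swap 4 a b, lieSym_swap 4 a c, lieSym_swap 4 a d, lieSym_swap 4 b c,
    lieSym_swap 4 b d, lieSym_swap 4 c d, lieSym_mul_comm b d a c, lieSym_mul_comm b c a d,
    lieSym_mul_comm c d a b, neg_mul, mul_neg, neg_neg, Units.val_one, Units.val_neg, Int.cast_one,
    Int.cast_neg, mul_one]
  module

theorem glD_derivedSymbol (i : ℕ) (g : GL (Fin n) ℂ) (a : derivedLie n) :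
    glD i g (derivedSymbol n i a)
      = derivedSymbol n i ⟨glAlg g a, glAlg_mem_derivedLie g a.2⟩ :=
  Gr.map_symbol _ (map_glAlg_mem_qFil i g) 1 ⟨Q.mk (An n) i a, mk_mem_qFil_one n i a⟩

theorem glD_lieSym (i : ℕ) (g : GL (Fin n) ℂ) (u v : Fin n → ℂ) :
    glD i g (lieSym n i u v) = lieSym n i (vecRep n g u) (vecRep n g v) := by
  rw [lieSym_apply, glD_derivedSymbol, lieSym_apply]
  refine congrArg (derivedSymbol n i) (Subtype.ext ?_)
  simp [LieRing.of_associative_ring_bracket, glAlg_vec]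

theorem glD_lieLieSym (g : GL (Fin n) ℂ) (u v w : Fin n → ℂ) :
    glD 4 g (lieLieSym n 4 u v w)
      = lieLieSym n 4 (vecRep n g u) (vecRep n g v) (vecRep n g w) := by
  rw [lieLieSym, glD_derivedSymbol, lieLieSym]
  refine congrArg (derivedSymbol n 4) (Subtype.ext ?_)
  simp [LieRing.of_associative_ring_bracket, glAlg_vec]

theorem tripleMap_cellTensorRep (g : GL (Fin n) ℂ) (t : CellTensor diagram21 n) :
    tripleMap n (cellTensorRep diagram21 n g t) = glD 4 g (tripleMap n t) := by
  suffices h : tripleMap n ∘ₗ cellTensorRep diagram21 n g = (glD 4 g).toLinearMap ∘ₗ tripleMap n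
    from LinearMap.congr_fun h t
  refine PiTensorProduct.ext (MultilinearMap.ext fun v => ?_)
  change tripleMap n (PiTensorProduct.map (fun _ => vecRep n g) (PiTensorProduct.tprod ℂ v))
    = glD 4 g (tripleMap n (PiTensorProduct.tprod ℂ v))
  rw [PiTensorProduct.map_tprod, tripleMap_tprod, tripleMap_tprod, glD_lieLieSym]

theorem pairMap_cellTensorRep (g : GL (Fin n) ℂ) (t : CellTensor diagram22 n) :
    pairMap n (cellTensorRep diagram22 n g t) = glD 4 g (pairMap n t) := by
  suffices h : pairMap n ∘ₗ cellTensorRep diagram22 n g = (glD 4 g).toLinearMap ∘ₗ pairMap n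
    from LinearMap.congr_fun h t
  refine PiTensorProduct.ext (MultilinearMap.ext fun v => ?_)
  change pairMap n (PiTensorProduct.map (fun _ => vecRep n g) (PiTensorProduct.tprod ℂ v))
    = glD 4 g (pairMap n (PiTensorProduct.tprod ℂ v))
  rw [PiTensorProduct.map_tprod, pairMap_tprod, pairMap_tprod, map_mul, glD_lieSym, glD_lieSym]

/-- A tensor of shape `(2,1)` with prescribed factors. -/
theorem exists_diagram21 (a b c : Fin n → ℂ) :
    ∃ v : diagram21.cells → Fin n → ℂ, v a00 = a ∧ v a01 = b ∧ v a10 = c := by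
  obtain ⟨h1, h2, h3, h4, h5, h6⟩ := ne_cell_diagram21
  exact ⟨fun e => if e = a00 then a else if e = a01 then b else c, by simp, by simp [h4],
    by simp [h5, h6]⟩

/-- A tensor of shape `(2,2)` with prescribed factors. -/
theorem exists_diagram22 (a b c d : Fin n → ℂ) :
    ∃ v : diagram22.cells → Fin n → ℂ, v b00 = a ∧ v b01 = b ∧ v b10 = c ∧ v b11 = d := by
  obtain ⟨h1, h2, h3, h4, h5, h6, h7, h8, h9, h10, h11, h12⟩ := ne_cell_diagram22
  exact ⟨fun e => if e = b00 then a else if e = b01 then b else if e = b10 then c else d,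
    by simp, by simp [h7], by simp [h8, h10], by simp [h9, h11, h12]⟩

theorem map_tripleMap_range :
    (LinearMap.range (youngSymmetrizer diagram21 n)).map (tripleMap n) = tripleSpan n := by
  refine le_antisymm ?_ (Submodule.span_le.2 ?_)
  · rintro _ ⟨_, ⟨t, rfl⟩, rfl⟩
    rw [tripleMap_youngSymmetrizer]
    refine Submodule.smul_mem _ _ ?_
    induction t using PiTensorProduct.induction_on with
    | smul_tprod r v =>
      rw [map_smul, tripleMap_tprod]
      exact Submodule.smul_mem _ _ (Submodule.subset_span ⟨_, _, _, rfl⟩)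
    | add x y hx hy => rw [map_add]; exact add_mem hx hy
  · rintro _ ⟨a, b, c, rfl⟩
    obtain ⟨v, rfl, rfl, rfl⟩ := exists_diagram21 a c b
    refine ⟨youngSymmetrizer diagram21 n ((3⁻¹ : ℂ) • PiTensorProduct.tprod ℂ v), ⟨_, rfl⟩, ?_⟩
    rw [tripleMap_youngSymmetrizer, map_smul, smul_smul, tripleMap_tprod,
      mul_inv_cancel₀ (by norm_num), one_smul]

theorem map_pairMap_range :
    (LinearMap.range (youngSymmetrizer diagram22 n)).map (pairMap n) = pluckerSpan n := by
  refine le_antisymm ?_ (Submodule.span_le.2 ?_)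
  · rintro _ ⟨_, ⟨t, rfl⟩, rfl⟩
    induction t using PiTensorProduct.induction_on with
    | smul_tprod r v =>
      rw [map_smul, map_smul, pairMap_youngSymmetrizer]
      exact Submodule.smul_mem _ _ (sub_mem
        (Submodule.smul_mem _ _ (Submodule.subset_span ⟨_, _, _, _, rfl⟩))
        (Submodule.smul_mem _ _ (Submodule.subset_span ⟨_, _, _, _, rfl⟩)))
    | add x y hx hy => rw [map_add, map_add]; exact add_mem hx hy
  · rintro _ ⟨a, b, c, d, rfl⟩
    obtain ⟨v, hv1, hv2, hv3, hv4⟩ := exists_diagram22 a b c d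
    obtain ⟨w, hw1, hw2, hw3, hw4⟩ := exists_diagram22 a b d c
    -- For the first tensor the symmetrizer gives 4(2[a,c][b,d] + [a,d][b,c] + [a,b][c,d]). Adding
    -- the same with `c` and `d` exchanged cancels [a,b][c,d] and leaves 12 times the Plücker
    -- symbol.
    refine ⟨youngSymmetrizer diagram22 n ((12⁻¹ : ℂ) •
      (PiTensorProduct.tprod ℂ v + PiTensorProduct.tprod ℂ w)), ⟨_, rfl⟩, ?_⟩
    rw [map_smul, map_smul, map_add, map_add, pairMap_youngSymmetrizer, pairMap_youngSymmetrizer,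
      hv1, hv2, hv3, hv4, hw1, hw2, hw3, hw4]
    simp only [plucker, lieSym_swap 4 b c, lieSym_swap 4 b d, lieSym_swap 4 c d, mul_neg]
    module

/-- A degree-one symbol vanishes only if the element is constant modulo M_4, which the matrix model
excludes. -/
theorem exists_lieLieSym_ne_zero (hn : 2 ≤ n) : ∃ u v : Fin n → ℂ, lieLieSym n 4 u v u ≠ 0 := by
  obtain ⟨u, v, h⟩ := mk_lie_lie_vec_notMem hn
  exact ⟨u, v, fun h0 => h ((Gr.symbol_eq_zero (qFil n 4) 1 _).1 h0)⟩

theorem exists_lieSym_mul_self_ne_zero (hn : 2 ≤ n) :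
    ∃ u v : Fin n → ℂ, lieSym n 4 u v * lieSym n 4 u v ≠ 0 := by
  obtain ⟨u, v, h⟩ := mk_lie_sq_notMem hn
  refine ⟨u, v, fun h0 => h ?_⟩
  rw [lieSym_apply, derivedSymbol_mul, Gr.symbol_eq_zero] at h0
  rw [map_mul]
  exact h0

theorem exists_tripleMap_youngSymmetrizer_ne_zero (hn : 2 ≤ n) :
    ∃ t, tripleMap n (youngSymmetrizer diagram21 n t) ≠ 0 := by
  obtain ⟨u, v, h⟩ := exists_lieLieSym_ne_zero hn
  obtain ⟨w, h1, h2, h3⟩ := exists_diagram21 u u v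
  refine ⟨PiTensorProduct.tprod ℂ w, ?_⟩
  rw [tripleMap_youngSymmetrizer, tripleMap_tprod, h1, h2, h3]
  exact smul_ne_zero (by norm_num) h

theorem exists_pairMap_youngSymmetrizer_ne_zero (hn : 2 ≤ n) :
    ∃ t, pairMap n (youngSymmetrizer diagram22 n t) ≠ 0 := by
  obtain ⟨u, v, h⟩ := exists_lieSym_mul_self_ne_zero hn
  obtain ⟨w, h1, h2, h3, h4⟩ := exists_diagram22 u u v v
  refine ⟨PiTensorProduct.tprod ℂ w, ?_⟩
  rw [pairMap_youngSymmetrizer, h1, h2, h3, h4]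
  -- The first Plücker symbol is 2[u,v]² and the second is -[u,v]², whence 8 + 4 = 12.
  have : (4 : ℂ) • plucker 4 u u v v - (4 : ℂ) • plucker 4 u v v u
      = (12 : ℂ) • (lieSym n 4 u v * lieSym n 4 u v) := by
    simp only [plucker, lieSym_self, lieSym_swap 4 u v, mul_neg, zero_mul]
    module
  rw [this]
  exact smul_ne_zero (by norm_num) h

theorem schurRep_diagram21_isIrreducible (hn : 2 ≤ n) : (schurRep diagram21 n).IsIrreducible := by
  obtain ⟨t, ht⟩ := exists_tripleMap_youngSymmetrizer_ne_zero hn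
  refine schurRep_isIrreducible n vonNeumann_diagram21 (by rw [hookProduct_diagram21]; norm_num)
    ⟨t, fun h => ht (by rw [h, map_zero])⟩

theorem schurRep_diagram22_isIrreducible (hn : 2 ≤ n) : (schurRep diagram22 n).IsIrreducible := by
  obtain ⟨t, ht⟩ := exists_pairMap_youngSymmetrizer_ne_zero hn
  refine schurRep_isIrreducible n vonNeumann_diagram22 (by rw [hookProduct_diagram22]; norm_num)
    ⟨t, fun h => ht (by rw [h, map_zero])⟩

/-- An equivariant map out of an irreducible Schur module that does not vanish is injective. -/
theorem injOn_range_of_ne_zero {μ : YoungDiagram} (hirr : (schurRep μ n).IsIrreducible)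
    (f : CellTensor μ n →ₗ[ℂ] D n 4)
    (hf : ∀ g t, f (cellTensorRep μ n g t) = glD 4 g (f t))
    (h0 : ∃ t, f (youngSymmetrizer μ n t) ≠ 0) {t : CellTensor μ n}
    (ht : t ∈ LinearMap.range (youngSymmetrizer μ n)) (hft : f t = 0) : t = 0 := by
  let ι : SchurModule μ n →ₗ[ℂ] CellTensor μ n :=
    (LinearMap.range (youngSymmetrizer μ n)).subtype
  let S : Subrepresentation (schurRep μ n) :=
    { toSubmodule := LinearMap.ker (f ∘ₗ ι)
      apply_mem_toSubmodule := fun g v hv => by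
        have hv' : f (ι v) = 0 := hv
        change f (cellTensorRep μ n g (ι v)) = 0
        rw [hf, hv', map_zero] }
  let y : SchurModule μ n := ⟨t, ht⟩
  have hy : y ∈ S.toSubmodule := hft
  rcases hirr.eq_bot_or_eq_top S with h | h
  · rw [h] at hy
    have hy0 : y = 0 := (Submodule.mem_bot ℂ).1 hy
    exact congrArg Subtype.val hy0
  · obtain ⟨s, hs⟩ := h0
    let z : SchurModule μ n := ⟨youngSymmetrizer μ n s, s, rfl⟩
    have hz : z ∈ S.toSubmodule := by rw [h]; exact Submodule.mem_top
    exact (hs hz).elim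

variable (n) in
/-- The map from `F_(2,1) ⊕ F_(2,2)` to `D_4`. -/
def schurToD : SchurModule diagram21 n × SchurModule diagram22 n →ₗ[ℂ] D n 4 :=
  (tripleMap n ∘ₗ (LinearMap.range (youngSymmetrizer diagram21 n)).subtype).coprod
    (pairMap n ∘ₗ (LinearMap.range (youngSymmetrizer diagram22 n)).subtype)

theorem schurToD_apply (x : SchurModule diagram21 n × SchurModule diagram22 n) :
    schurToD n x = tripleMap n x.1.1 + pairMap n x.2.1 := rfl

theorem tripleMap_mem_tripleSpan (x : SchurModule diagram21 n) :
    tripleMap n x.1 ∈ tripleSpan n :=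
  map_tripleMap_range (n := n) ▸ Submodule.mem_map_of_mem x.2

theorem pairMap_mem_pluckerSpan (x : SchurModule diagram22 n) :
    pairMap n x.1 ∈ pluckerSpan n :=
  map_pairMap_range (n := n) ▸ Submodule.mem_map_of_mem x.2

theorem tripleSpan_le_symbol :
    tripleSpan n ≤ LinearMap.range (Gr.symbol (qFil n 4) 1) := by
  refine Submodule.span_le.2 ?_
  rintro _ ⟨a, b, c, rfl⟩
  exact ⟨_, rfl⟩

theorem pluckerSpan_le_symbol :
    pluckerSpan n ≤ LinearMap.range (Gr.symbol (qFil n 4) 2) := by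
  refine Submodule.span_le.2 ?_
  rintro _ ⟨a, b, c, d, rfl⟩
  simp only [plucker, lieSym_apply, derivedSymbol_mul]
  exact add_mem ⟨_, rfl⟩ ⟨_, rfl⟩

theorem schurToD_injective (hn : 2 ≤ n) : Function.Injective (schurToD n) := by
  refine (injective_iff_map_eq_zero _).2 fun x hx => ?_
  rw [schurToD_apply] at hx
  have h1 : tripleMap n x.1.1 = 0 := by
    obtain ⟨a, ha⟩ := tripleSpan_le_symbol (tripleMap_mem_tripleSpan x.1)
    obtain ⟨b, hb⟩ := pluckerSpan_le_symbol (pairMap_mem_pluckerSpan x.2)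
    rw [← ha, ← hb] at hx
    rw [← ha]
    -- The two components live in degrees one and two of the associated graded algebra, so they
    -- vanish separately.
    exact Gr.symbol_eq_zero_of_add (qFil n 4) (by norm_num) a b hx
  rw [h1, zero_add] at hx
  refine Prod.ext (Subtype.ext ?_) (Subtype.ext ?_)
  · exact injOn_range_of_ne_zero (schurRep_diagram21_isIrreducible hn) _ tripleMap_cellTensorRep
      (exists_tripleMap_youngSymmetrizer_ne_zero hn) x.1.2 h1
  · exact injOn_range_of_ne_zero (schurRep_diagram22_isIrreducible hn) _ pairMap_cellTensorRep
      (exists_pairMap_youngSymmetrizer_ne_zero hn) x.2.2 hx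

theorem range_schurToD : LinearMap.range (schurToD n) = tripleSpan n ⊔ pluckerSpan n := by
  refine le_antisymm ?_ (sup_le ?_ ?_)
  · rintro _ ⟨x, rfl⟩
    rw [schurToD_apply]
    exact Submodule.add_mem_sup (tripleMap_mem_tripleSpan x.1) (pairMap_mem_pluckerSpan x.2)
  · rw [← map_tripleMap_range]
    rintro _ ⟨t, ht, rfl⟩
    refine ⟨(⟨t, ht⟩, 0), ?_⟩
    rw [schurToD_apply]
    change tripleMap n t + pairMap n 0 = tripleMap n t
    rw [map_zero, add_zero]
  · rw [← map_pairMap_range]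
    rintro _ ⟨t, ht, rfl⟩
    refine ⟨(0, ⟨t, ht⟩), ?_⟩
    rw [schurToD_apply]
    change tripleMap n 0 + pairMap n t = pairMap n t
    rw [map_zero, zero_add]

theorem schurToD_mem_Lam (x : SchurModule diagram21 n × SchurModule diagram22 n) :
    schurToD n x ∈ (Lam n 4).toSubmodule :=
  add_mem (tripleSpan_le_Lam (tripleMap_mem_tripleSpan x.1))
    (pluckerSpan_le_Lam (pairMap_mem_pluckerSpan x.2))

theorem mem_K {x : Lam n 4} : x ∈ (K n 3).toSubmodule ↔ projD n 3 x = 0 :=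
  ⟨fun h => congrArg Subtype.val (LinearMap.mem_ker.1 h),
    fun h => LinearMap.mem_ker.2 (Subtype.ext h)⟩

variable (n) in
/-- The map from `F_(2,1) ⊕ F_(2,2)` to `K_3`. -/
def schurToK : SchurModule diagram21 n × SchurModule diagram22 n →ₗ[ℂ] (K n 3).toSubmodule :=
  ((schurToD n).codRestrict (Lam n 4).toSubmodule schurToD_mem_Lam).codRestrict
    (K n 3).toSubmodule fun x => mem_K.2 (projD_eq_zero_of_mem (by
      rw [← range_schurToD]; exact ⟨x, rfl⟩))

theorem schurToK_bijective (hn : 2 ≤ n) : Function.Bijective (schurToK n) := by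
  refine ⟨fun x y h => schurToD_injective hn (congrArg Subtype.val (congrArg Subtype.val h)),
    fun y => ?_⟩
  have h := mem_of_projD_eq_zero y.1.2 (mem_K.1 y.2)
  rw [← range_schurToD] at h
  obtain ⟨x, hx⟩ := h
  exact ⟨x, Subtype.ext (Subtype.ext hx)⟩

theorem schurToK_equivariant (g : GL (Fin n) ℂ)
    (x : SchurModule diagram21 n × SchurModule diagram22 n) :
    schurToK n (((schurRep diagram21 n).prod (schurRep diagram22 n)) g x)
      = (K n 3).toRepresentation g (schurToK n x) := by
  refine Subtype.ext (Subtype.ext ?_)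
  change tripleMap n (cellTensorRep diagram21 n g x.1.1)
    + pairMap n (cellTensorRep diagram22 n g x.2.1) = glD 4 g (schurToD n x)
  rw [tripleMap_cellTensorRep, pairMap_cellTensorRep, schurToD_apply, map_add]

end Schur

end LieNilpotent
end

theorem corollary4p3 (n : ℕ) (hn : 2 ≤ n) :
    (LieNilpotent.schurRep LieNilpotent.diagram21 n).IsIrreducible ∧
    (LieNilpotent.schurRep LieNilpotent.diagram22 n).IsIrreducible ∧
    Nonempty ((LieNilpotent.K n 3).toRepresentation.Equiv
      ((LieNilpotent.schurRep LieNilpotent.diagram21 n).prod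
        (LieNilpotent.schurRep LieNilpotent.diagram22 n))) := by
  refine ⟨LieNilpotent.schurRep_diagram21_isIrreducible hn,
    LieNilpotent.schurRep_diagram22_isIrreducible hn, ⟨Representation.Equiv.symm ?_⟩⟩
  exact Representation.Equiv.mk
    (LinearEquiv.ofBijective (LieNilpotent.schurToK n) (LieNilpotent.schurToK_bijective hn))
    fun g => LinearMap.ext fun x => LieNilpotent.schurToK_equivariant g x
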